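/- **Maps.** Let $\Gamma=\langle R_0,R_1,R_2\mid R_0^2=R_1^2=R_2^2=(R_0R_2)^2=1\rangle$ and $E=\langle R_0,R_2\rangle\cong V_4$. A *map* $\mathcal M$ (connected, possibly infinite or non-orientable, possibly with boundary or free edges) is a transitive permutation representation $R_i\mapsto r_i$ of $\Gamma$ on a non-empty set $\Phi$, the set of flags of $\mathcal M$. Two maps are isomorphic if there is a bijection between their sets of flags commuting with $r_0,r_1,r_2$. The edges of $\mathcal M$ are the orbits of $\langle r_0,r_2\rangle$ on $\Phi$. The automorphism group ${\rm Aut}\,\mathcal M$ is the centraliser of $\langle r_0,r_1,r_2\rangle$ in ${\rm Sym}\,\Phi$; $\mathcal M$ is *edge-transitive* if ${\rm Aut}\,\mathcal M$ is transitive on its edges. The quotient map $\mathcal M/{\rm Aut}\,\mathcal M$ is given by the induced action of $\Gamma$ on the set of orbits of ${\rm Aut}\,\mathcal M$ on $\Phi$. **Classes.** There are $14$ Graver–Watkins classes $T$ of edge-transitive maps, labelled $1$, $2^\sigma$, $2^\sigma{\rm ex}$, $3$, $4^\sigma$, $5^\sigma$ with $\sigma\in\{\emptyset,*,P\}$. An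 edge-transitive map $\mathcal M$ is in class $T$ if $\mathcal M/{\rm Aut}\,\mathcal M\cong\mathcal N(T)$, where $\mathcal N(T)$ is the following one-edge map. - $\mathcal N(1)$ has one flag. - The maps $\mathcal N(2)$, $\mathcal N(2^*)$, $\mathcal N(2^P)$, $\mathcal N(2\,{\rm ex})$, $\mathcal N(2^*{\rm ex})$, $\mathcal N(2^P{\rm ex})$ have two flags; the sets of those $r_i$ which transpose the two flags (the other $r_i$ being trivial) are, respectively, $\{r_0\}$, $\{r_2\}$, $\{r_0,r_2\}$, $\{r_0,r_1\}$, $\{r_1,r_2\}$, $\{r_0,r_1,r_2\}$. - $\mathcal N(3)$, $\mathcal N(4^\sigma)$, $\mathcal N(5^\sigma)$ have four flags, on which $E$ acts regularly. Put $t=r_2$, $r_0$, $r_0r_2$ for $\sigma=\emptyset$, $*$, $P$ respectively. In $\mathcal N(3)$, $r_1$ is trivial; in $\mathcal N(4^\sigma)$, $r_1$ fixes both flags of one orbit of $\langle t\rangle$ and transposes the two flags of the other orbit; in $\mathcal N(5^\sigma)$, $r_1=t$. Let $\mathcal G(T)$ be the class of groups isomorphic to ${\rm Aut}\,\mathcal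 M$ for some map $\mathcal M$ in class $T$. **Theorem.** Let $U_3(3)=PSU_3(3)$ be the group of $3\times3$ matrices over $\mathbb F_9$ of determinant $1$ preserving the standard Hermitian form, modulo its centre. For each of the $14$ classes $T$, $$U_3(3)\in\mathcal G(T)\iff T=3,\ \text{or } T=4^\sigma \text{ for some }\sigma\in\{\emptyset,*,P\},\ \text{or } T=5^\sigma\text{ for some }\sigma\in\{\emptyset,*,P\}.$$ -/

import Mathlib

/-!
Maps on surfaces (possibly non-orientable, possibly with boundary, possibly infinite, possibly with
free edges) in their algebraic form, the fourteen Graver--Watkins classes of edge-transitive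
maps, and the unitary group `U_3(3)`.
-/

/-- A (connected) map, given by its set of flags and the permutations `r₀`, `r₁`, `r₂` which change
the vertex, the edge, the face of a flag where this is possible and fix the flag otherwise.
Equivalently, a transitive permutation representation of the group
`Γ = ⟨R₀, R₁, R₂ ∣ R₀² = R₁² = R₂² = (R₀R₂)² = 1⟩`. As `Γ` is countable, so is the set of flags,
and hence flag sets in `Type` cover all maps up to isomorphism. -/
structure FlagMap where
  /-- the set of flags -/
  Flag : Type
  nonempty : Nonempty Flag
  r₀ : Equiv.Perm Flag
  r₁ : Equiv.Perm Flag
  r₂ : Equiv.Perm Flag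
  r₀_sq : r₀ ^ 2 = 1
  r₁_sq : r₁ ^ 2 = 1
  r₂_sq : r₂ ^ 2 = 1
  r₀r₂_sq : (r₀ * r₂) ^ 2 = 1
  connected : ∀ x y : Flag, ∃ g ∈ Subgroup.closure {r₀, r₁, r₂}, g x = y

namespace FlagMap

/-- The monodromy group, generated by `r₀`, `r₁`, `r₂`. -/
def monodromy (M : FlagMap) : Subgroup (Equiv.Perm M.Flag) :=
  Subgroup.closure {M.r₀, M.r₁, M.r₂}

/-- The automorphism group: the centraliser of the monodromy group in the symmetric group. -/
def Aut (M : FlagMap) : Subgroup (Equiv.Perm M.Flag) :=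
  Subgroup.centralizer (M.monodromy : Set (Equiv.Perm M.Flag))

/-- The edges of a map are the orbits of the group `⟨r₀, r₂⟩` on flags. -/
def edgeGroup (M : FlagMap) : Subgroup (Equiv.Perm M.Flag) :=
  Subgroup.closure {M.r₀, M.r₂}

/-- The automorphism group is transitive on edges. -/
def IsEdgeTransitive (M : FlagMap) : Prop :=
  ∀ x y : M.Flag, ∃ a ∈ M.Aut, a x ∈ MulAction.orbit M.edgeGroup y

/-- Isomorphism of maps: a bijection between the flags which commutes with `r₀`, `r₁`, `r₂`. -/
def Isomorphic (M N : FlagMap) : Prop :=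
  ∃ f : M.Flag ≃ N.Flag,
    (∀ x, f (M.r₀ x) = N.r₀ (f x)) ∧ (∀ x, f (M.r₁ x) = N.r₁ (f x)) ∧
      (∀ x, f (M.r₂ x) = N.r₂ (f x))

/-- The flags of the quotient map `M / Aut M`: the orbits of `Aut M` on the flags of `M`. -/
abbrev QuotFlag (M : FlagMap) : Type := MulAction.orbitRel.Quotient M.Aut M.Flag

/-- The permutation of the orbits of `Aut M` induced by an element of the monodromy group. -/
def quotPerm (M : FlagMap) (r : Equiv.Perm M.Flag) (hr : r ∈ M.monodromy) :
    Equiv.Perm M.QuotFlag :=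
  Quotient.congr r (by
    have key : ∀ a ∈ M.Aut, ∀ z : M.Flag, r (a z) = a (r z) := fun a ha z =>
      DFunLike.congr_fun (Subgroup.mem_centralizer_iff.1 ha r hr) z
    intro x y
    change x ∈ MulAction.orbit M.Aut y ↔ r x ∈ MulAction.orbit M.Aut (r y)
    constructor
    · rintro ⟨⟨a, ha⟩, h⟩
      refine ⟨⟨a, ha⟩, ?_⟩
      change a y = x at h
      change a (r y) = r x
      rw [← key a ha, h]
    · rintro ⟨⟨a, ha⟩, h⟩
      refine ⟨⟨a, ha⟩, ?_⟩
      change a (r y) = r x at h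
      change a y = x
      rw [← key a ha] at h
      exact r.injective h)

theorem r₀_mem (M : FlagMap) : M.r₀ ∈ M.monodromy := Subgroup.subset_closure (by simp)
theorem r₁_mem (M : FlagMap) : M.r₁ ∈ M.monodromy := Subgroup.subset_closure (by simp)
theorem r₂_mem (M : FlagMap) : M.r₂ ∈ M.monodromy := Subgroup.subset_closure (by simp)

theorem quotPerm_mk (M : FlagMap) (r : Equiv.Perm M.Flag) (hr : r ∈ M.monodromy) (x : M.Flag) :
    M.quotPerm r hr (Quotient.mk _ x) = Quotient.mk _ (r x) := rfl

theorem apply_apply_of_sq {α : Type} {r : Equiv.Perm α} (h : r ^ 2 = 1) (x : α) :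
    r (r x) = x := by
  rw [← Equiv.Perm.mul_apply, ← pow_two, h, Equiv.Perm.one_apply]

/-- The quotient map `M / Aut M`. -/
def quotientMap (M : FlagMap) : FlagMap where
  Flag := M.QuotFlag
  nonempty := M.nonempty.map (Quotient.mk _)
  r₀ := M.quotPerm M.r₀ M.r₀_mem
  r₁ := M.quotPerm M.r₁ M.r₁_mem
  r₂ := M.quotPerm M.r₂ M.r₂_mem
  r₀_sq := by
    ext x
    induction x using Quotient.inductionOn with
    | h x => simp [pow_two, quotPerm_mk, apply_apply_of_sq M.r₀_sq]
  r₁_sq := by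
    ext x
    induction x using Quotient.inductionOn with
    | h x => simp [pow_two, quotPerm_mk, apply_apply_of_sq M.r₁_sq]
  r₂_sq := by
    ext x
    induction x using Quotient.inductionOn with
    | h x => simp [pow_two, quotPerm_mk, apply_apply_of_sq M.r₂_sq]
  r₀r₂_sq := by
    ext x
    induction x using Quotient.inductionOn with
    | h x =>
      have h := apply_apply_of_sq M.r₀r₂_sq x
      simp only [Equiv.Perm.mul_apply] at h
      simp [pow_two, quotPerm_mk, h]
  connected := by
    intro x y
    induction x using Quotient.inductionOn with
    | h x =>
    induction y using Quotient.inductionOn with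
    | h y =>
    obtain ⟨g, hg, rfl⟩ := M.connected x y
    have hg' : g ∈ M.monodromy := hg
    suffices h : M.quotPerm g hg' ∈ Subgroup.closure
        {M.quotPerm M.r₀ M.r₀_mem, M.quotPerm M.r₁ M.r₁_mem, M.quotPerm M.r₂ M.r₂_mem} from
      ⟨_, h, rfl⟩
    clear x
    induction hg using Subgroup.closure_induction with
    | mem g h =>
      apply Subgroup.subset_closure
      rcases h with rfl | rfl | rfl <;> simp
    | one =>
      convert Subgroup.one_mem _
      ext x
      induction x using Quotient.inductionOn with
      | h x => rfl
    | mul a b ha hb iha ihb =>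
      convert Subgroup.mul_mem _ (iha ha) (ihb hb) using 1
      ext x
      induction x using Quotient.inductionOn with
      | h x => rfl
    | inv a ha iha =>
      convert Subgroup.inv_mem _ (iha ha) using 1
      rw [eq_inv_iff_mul_eq_one]
      ext x
      induction x using Quotient.inductionOn with
      | h x =>
        change Quotient.mk _ (a⁻¹ (a x)) = Quotient.mk _ x
        simp

/-! ### The basic maps with one edge -/

/-- The basic map with one flag, on which `r₀`, `r₁`, `r₂` act trivially. -/
def basicOne : FlagMap where
  Flag := Unit
  nonempty := ⟨()⟩
  r₀ := 1
  r₁ := 1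
  r₂ := 1
  r₀_sq := rfl
  r₁_sq := rfl
  r₂_sq := rfl
  r₀r₂_sq := rfl
  connected := fun _ _ => ⟨1, Subgroup.one_mem _, rfl⟩

/-- The identity or the transposition of the two elements of `Bool`. -/
def flip (a : Bool) : Equiv.Perm Bool := if a then Equiv.boolNot else 1

/-- The basic map with two flags in which `rᵢ` transposes the two flags if the corresponding Boolean
is `true` and fixes both of them otherwise. -/
def basicTwo (a₀ a₁ a₂ : Bool) (h : (a₀ || a₁ || a₂) = true) : FlagMap where
  Flag := Bool
  nonempty := ⟨false⟩
  r₀ := flip a₀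
  r₁ := flip a₁
  r₂ := flip a₂
  r₀_sq := by clear h; revert a₀; decide
  r₁_sq := by clear h; revert a₁; decide
  r₂_sq := by clear h; revert a₂; decide
  r₀r₂_sq := by clear h; revert a₀ a₂; decide
  connected := by
    have hm : Equiv.boolNot ∈ Subgroup.closure {flip a₀, flip a₁, flip a₂} := by
      apply Subgroup.subset_closure
      revert h a₀ a₁ a₂
      simp [flip]
    intro x y
    by_cases hxy : x = y
    · exact ⟨1, Subgroup.one_mem _, hxy⟩
    · exact ⟨_, hm, by revert x y; decide⟩

/-- The transposition of the values of the first coordinate. -/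
def flipFst : Equiv.Perm (Bool × Bool) := Equiv.prodCongr Equiv.boolNot (Equiv.refl Bool)

/-- The transposition of the values of the second coordinate. -/
def flipSnd : Equiv.Perm (Bool × Bool) := Equiv.prodCongr (Equiv.refl Bool) Equiv.boolNot

/-- The basic map with four flags, on which `⟨r₀, r₂⟩` acts as a regular four-group, and with the
given permutation `r₁`. -/
def basicFour (s : Equiv.Perm (Bool × Bool)) (hs : s ^ 2 = 1) : FlagMap where
  Flag := Bool × Bool
  nonempty := ⟨(false, false)⟩
  r₀ := flipFst
  r₁ := s
  r₂ := flipSnd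
  r₀_sq := by decide
  r₁_sq := hs
  r₂_sq := by decide
  r₀r₂_sq := by decide
  connected := by
    have h0 : flipFst ∈ Subgroup.closure {flipFst, s, flipSnd} :=
      Subgroup.subset_closure (by simp)
    have h2 : flipSnd ∈ Subgroup.closure {flipFst, s, flipSnd} :=
      Subgroup.subset_closure (by simp)
    have key : ∀ x y : Bool × Bool, (1 : Equiv.Perm (Bool × Bool)) x = y ∨ flipFst x = y ∨
        flipSnd x = y ∨ (flipFst * flipSnd) x = y := by decide
    intro x y
    rcases key x y with h | h | h | h
    · exact ⟨_, Subgroup.one_mem _, h⟩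
    · exact ⟨_, h0, h⟩
    · exact ⟨_, h2, h⟩
    · exact ⟨_, Subgroup.mul_mem _ h0 h2, h⟩

end FlagMap

/-- The superscript `σ` of a class: empty, `*` or `P`. -/
inductive ClassSuffix
  | none
  | star
  | petrie

/-- The labels `1`, `2^σ`, `2^σ ex`, `3`, `4^σ`, `5^σ` of the fourteen classes of edge-transitive
maps. -/
inductive EdgeClass
  | one
  | two (σ : ClassSuffix)
  | twoEx (σ : ClassSuffix)
  | three
  | four (σ : ClassSuffix)
  | five (σ : ClassSuffix)

open FlagMap in
/-- The basic map `𝒩(T)` of each class `T`: the class of `T` without superscript is drawn below,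
the classical dual `*` exchanges the roles of `r₀` and `r₂`, and `P` is obtained from `*`
by Petrie duality, which replaces `r₀` by `r₀ r₂`. -/
def EdgeClass.basicMap : EdgeClass → FlagMap
  | .one => basicOne
  -- two vertices and an edge joining them, which lies in the boundary of a disc
  | .two .none => basicTwo true false false rfl
  | .two .star => basicTwo false false true rfl
  | .two .petrie => basicTwo true false true rfl
  -- a vertex and a loop, which is the boundary of a disc
  | .twoEx .none => basicTwo true true false rfl
  | .twoEx .star => basicTwo false true true rfl
  -- the sphere with a vertex and a free edge
  | .twoEx .petrie => basicTwo true true true rfl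
  -- a disc with an edge joining two vertices on the boundary
  | .three => basicFour 1 (one_pow 2)
  -- a disc with an edge joining a vertex on the boundary to an interior vertex
  | .four .none => basicFour (Equiv.swap (true, false) (true, true)) (by decide)
  | .four .star => basicFour (Equiv.swap (false, true) (true, true)) (by decide)
  | .four .petrie => basicFour (Equiv.swap (true, false) (false, true)) (by decide)
  -- the sphere with an edge joining two vertices
  | .five .none => basicFour flipSnd (by decide)
  | .five .star => basicFour flipFst (by decide)
  | .five .petrie => basicFour (flipFst * flipSnd) (by decide)

/-- The edge-transitive map `M` belongs to the class `T`: its quotient `M / Aut M` is isomorphic to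
the basic map `𝒩(T)`. -/
def FlagMap.InClass (M : FlagMap) (T : EdgeClass) : Prop :=
  M.IsEdgeTransitive ∧ M.quotientMap.Isomorphic T.basicMap

/-- `G ∈ 𝒢(T)`: the group `G` is isomorphic to the automorphism group of a map in the class `T`. -/
def RealisedInClass (G : Type*) [Group G] (T : EdgeClass) : Prop :=
  ∃ M : FlagMap, M.InClass T ∧ Nonempty (G ≃* M.Aut)

/-! ### The group `U_3(3)` -/

/-- The field `𝔽₉ = 𝔽₃(i)`, `i² = -1`. Its `star` is the conjugation `i ↦ -i`. -/
abbrev F9 : Type := QuadraticAlgebra (ZMod 3) (-1) 0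

instance F9.fact : Fact (∀ r : ZMod 3, r ^ 2 ≠ (-1 : ZMod 3) + 0 * r) := ⟨by decide⟩

theorem F9.card : Nat.card F9 = 9 := by
  rw [Nat.card_congr (QuadraticAlgebra.equivProd (-1 : ZMod 3) 0)]
  simp

/-- The conjugation of `𝔽₉` is the automorphism `x ↦ x³` which defines Hermitian forms. -/
theorem F9.star_eq (x : F9) : star x = x ^ 3 := by
  obtain ⟨a, b⟩ := x
  revert a b
  decide

/-- `U_3(3) = PSU₃(3)`: the group of `3 × 3` matrices over `𝔽₉` of determinant `1` which
preserve the standard Hermitian form, modulo its centre. -/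
abbrev U33 : Type :=
  Matrix.specialUnitaryGroup (Fin 3) F9 ⧸
    Subgroup.center (Matrix.specialUnitaryGroup (Fin 3) F9)

/-! The centre of `SU₃(3)` is trivial, so `U₃(3)` may be replaced by `SU33`. Its involutions are the
matrices `-1 - v v*` with `v` of norm `1` (`eq_one_or_eq_invol`). They correspond to the 63
non-isotropic points of the projective plane over `𝔽₉`, form one conjugacy class and generate the
group. With points coded as natural numbers, questions of generation become orbit computations: a
subgroup that contains an involution and is transitive on the points is the whole group, while a
subgroup with a proper non-empty invariant set of points is not.

`Aut M` acts semiregularly on flags, so `M / Aut M` yields generators of `Aut M`. In the classes `1`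
and `2^σ` it is generated by three elements of square `1`, which is impossible in `SU33`
(`closure_ne_top_of_sq`). In the classes `2^σ ex` it is generated by `c` and `d` with `c² = 1`, and
no group automorphism fixes `c` and inverts `d`, since it would induce an automorphism of the map
exchanging the two orbits of flags. In `SU33` such a group automorphism always exists
(`exists_mulEquiv_inv`). Indeed, if `invol v` and `x` generate, then `v` is a cyclic vector for `x`,
and the matrix `P` taking `xⁱ v` to `(xᵀ)ⁱ v̄` conjugates both generators to their transposes;
combining `P` with inverse transposition, which on unitary matrices is the field conjugation, gives
the automorphism.

In the classes `3`, `4^σ`, `5^σ` suitable generators serve as voltages on the four flags of the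
basic map. The resulting cover has the group `G` acting by left translations, and `G` is all of
`Aut` as soon as closed walks distinguish the base flag from the other three
(`realisedInClass_of_voltage`). Explicit generators and relations finish the proof. -/

/-! ### Reflections in the special unitary group of degree three over `𝔽₉` -/

/-- The group `SU₃(3)`. -/
abbrev SU33 : Type := Matrix.specialUnitaryGroup (Fin 3) F9

namespace SU33

open Matrix

theorem three_eq_zero : (3 : F9) = 0 := by decide

theorem coe_mul_coe_star (g : SU33) : g.1 * star g.1 = 1 :=
  (Matrix.mem_unitaryGroup_iff).1 (Matrix.mem_specialUnitaryGroup_iff.1 g.2).1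

theorem coe_star_mul_coe (g : SU33) : star g.1 * g.1 = 1 :=
  (Matrix.mem_unitaryGroup_iff').1 (Matrix.mem_specialUnitaryGroup_iff.1 g.2).1

theorem coe_inv (g : SU33) : (g⁻¹).1 = star g.1 := rfl

theorem det_coe (g : SU33) : g.1.det = 1 := (Matrix.mem_specialUnitaryGroup_iff.1 g.2).2

theorem star_mulVec_dotProduct (g : SU33) (v w : Fin 3 → F9) :
    star (g.1 *ᵥ v) ⬝ᵥ (g.1 *ᵥ w) = star v ⬝ᵥ w := by
  rw [star_mulVec, dotProduct_mulVec, vecMul_vecMul, ← star_eq_conjTranspose, coe_star_mul_coe,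
    vecMul_one]

/-- The matrix `-1 - v v*`. If `v` has norm `1`, it fixes `v` and is `-1` on the orthogonal
complement of `v`. -/
def reflMatrix (v : Fin 3 → F9) : Matrix (Fin 3) (Fin 3) F9 := -1 - vecMulVec v (star v)

theorem reflMatrix_mulVec (v w : Fin 3 → F9) :
    reflMatrix v *ᵥ w = -(w + (star v ⬝ᵥ w) • v) := by
  simp only [reflMatrix, sub_mulVec, neg_mulVec, one_mulVec, vecMulVec_mulVec]
  funext i
  simp only [Pi.sub_apply, Pi.neg_apply, Pi.add_apply, Pi.smul_apply, smul_eq_mul,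
    MulOpposite.smul_eq_mul_unop, MulOpposite.unop_op]
  ring

theorem star_reflMatrix (v : Fin 3 → F9) : star (reflMatrix v) = reflMatrix v := by
  simp [reflMatrix, star_eq_conjTranspose, conjTranspose_vecMulVec]

theorem reflMatrix_mul_self {v : Fin 3 → F9} (h : star v ⬝ᵥ v = 1) :
    reflMatrix v * reflMatrix v = 1 := by
  have e : vecMulVec v (star v) * vecMulVec v (star v) = vecMulVec v (star v) := by
    rw [vecMulVec_mul_vecMulVec, h, one_smul]
  have h3 : (3 : Matrix (Fin 3) (Fin 3) F9) = 0 := by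
    rw [← map_ofNat (algebraMap F9 (Matrix (Fin 3) (Fin 3) F9)) 3, three_eq_zero, map_zero]
  rw [reflMatrix]
  linear_combination (norm := noncomm_ring) e + h3 * vecMulVec v (star v)

theorem det_reflMatrix {v : Fin 3 → F9} (h : star v ⬝ᵥ v = 1) : (reflMatrix v).det = 1 := by
  simp only [dotProduct, Fin.sum_univ_three, Pi.star_apply] at h
  simp only [reflMatrix, det_fin_three, Matrix.sub_apply, Matrix.neg_apply, one_apply, vecMulVec_apply,
    Pi.star_apply]
  simp only [Fin.isValue, Fin.reduceEq, if_true, if_false]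
  linear_combination -h - three_eq_zero

theorem reflMatrix_mem {v : Fin 3 → F9} (h : star v ⬝ᵥ v = 1) :
    reflMatrix v ∈ specialUnitaryGroup (Fin 3) F9 := by
  rw [mem_specialUnitaryGroup_iff, mem_unitaryGroup_iff, star_reflMatrix]
  exact ⟨reflMatrix_mul_self h, det_reflMatrix h⟩

/-- The involution of `SU₃(3)` with fixed vector `v`, if `v` has norm `1`. -/
def invol (v : Fin 3 → F9) : SU33 :=
  if h : star v ⬝ᵥ v = 1 then ⟨reflMatrix v, reflMatrix_mem h⟩ else 1

theorem coe_invol {v : Fin 3 → F9} (h : star v ⬝ᵥ v = 1) : (invol v).1 = reflMatrix v := by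
  rw [invol, dif_pos h]

theorem invol_mul_self (v : Fin 3 → F9) : invol v * invol v = 1 := by
  by_cases h : star v ⬝ᵥ v = 1
  · apply Subtype.ext
    change (invol v).1 * (invol v).1 = 1
    rw [coe_invol h, reflMatrix_mul_self h]
  · rw [invol, dif_neg h, one_mul]

theorem invol_inv (v : Fin 3 → F9) : (invol v)⁻¹ = invol v :=
  inv_eq_of_mul_eq_one_left (invol_mul_self v)

/-- A unitary `g` carries `v v*` to `(g v)(g v)*`. If the norm of `v` is not `1`, both sides are the
default value `1`. -/
theorem conj_invol (g : SU33) (v : Fin 3 → F9) :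
    g * invol v * g⁻¹ = invol (g.1 *ᵥ v) := by
  by_cases h : star v ⬝ᵥ v = 1
  · have h' : star (g.1 *ᵥ v) ⬝ᵥ (g.1 *ᵥ v) = 1 := by rw [star_mulVec_dotProduct, h]
    apply Subtype.ext
    change g.1 * (invol v).1 * star g.1 = _
    rw [coe_invol h, coe_invol h', reflMatrix, reflMatrix, star_mulVec, ← vecMulVec_mul,
      ← mul_vecMulVec, mul_sub, sub_mul, mul_neg, mul_one, neg_mul, coe_mul_coe_star,
      star_eq_conjTranspose]
  · have h' : ¬ star (g.1 *ᵥ v) ⬝ᵥ (g.1 *ᵥ v) = 1 := by rwa [star_mulVec_dotProduct]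
    rw [invol, invol, dif_neg h, dif_neg h', mul_one, mul_inv_cancel]

theorem invol_smul {l : F9} (hl : star l * l = 1) (v : Fin 3 → F9) : invol (l • v) = invol v := by
  have e : star (l • v) ⬝ᵥ (l • v) = star v ⬝ᵥ v := by
    rw [star_smul, smul_dotProduct, dotProduct_smul, smul_smul, hl, one_smul]
  by_cases h : star v ⬝ᵥ v = 1
  · apply Subtype.ext
    rw [coe_invol h, coe_invol (e.trans h), reflMatrix, reflMatrix]
    congr 1
    ext1 i j
    simp only [vecMulVec_apply, Pi.star_apply, Pi.smul_apply, smul_eq_mul, star_mul]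
    linear_combination v i * star (v j) * hl
  · rw [invol, invol, dif_neg h, dif_neg (by rwa [e])]

theorem eq_smul_of_invol_eq {v w : Fin 3 → F9} (hv : star v ⬝ᵥ v = 1) (hw : star w ⬝ᵥ w = 1)
    (h : invol v = invol w) : w = (star v ⬝ᵥ w) • v := by
  have h1 : reflMatrix v *ᵥ w = reflMatrix w *ᵥ w := by
    rw [← coe_invol hv, ← coe_invol hw, h]
  rw [reflMatrix_mulVec, reflMatrix_mulVec, hw, one_smul, neg_inj, add_right_inj] at h1
  exact h1.symm

/-- Every element of `SU₃(3)` whose square is `1` is either the identity or one of the involutions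
`invol v`. -/
theorem eq_one_or_eq_invol {a : SU33} (ha : a ^ 2 = 1) :
    a = 1 ∨ ∃ v, star v ⬝ᵥ v = 1 ∧ a = invol v := by
  set A := a.1 with hA
  have hAA : A * A = 1 := by
    have := congrArg Subtype.val ha
    rwa [pow_two] at this
  have hS : star A = A := by
    rw [← coe_inv, inv_eq_of_mul_eq_one_left (by rwa [pow_two] at ha : a * a = 1)]
  have hdet : A.det = 1 := det_coe a
  have hadj : adjugate A = A := by
    have h := mul_adjugate A
    rw [hdet, one_smul] at h
    calc adjugate A = A * A * adjugate A := by rw [hAA, one_mul]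
      _ = A := by rw [mul_assoc, h, mul_one]
  have hadj' : ∀ i j, adjugate A i j = A i j := fun i j => by rw [hadj]
  have hAA' : ∀ i j, (A * A) i j = (1 : Matrix (Fin 3) (Fin 3) F9) i j := fun i j => by rw [hAA]
  have hS' : ∀ i j, star (A i j) = A j i := fun i j => by
    conv_rhs => rw [← hS]
    rfl
  have e00 := hadj' 0 0
  have e11 := hadj' 1 1
  have e22 := hadj' 2 2
  have k0 := hAA' 0 0
  have k1 := hAA' 1 1
  have k2 := hAA' 2 2
  simp only [adjugate_fin_three, of_apply, cons_val', cons_val_zero, cons_val_one, cons_val,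
    cons_val_fin_one, mul_apply, Fin.sum_univ_three, one_apply, if_true] at e00 e11 e22 k0 k1 k2
  -- Since `A` is its own adjugate, the sum of its principal minors of order two is its trace, and
  -- `tr(A²) = 3 = 0`. Trace `0` will force `A` to be scalar; trace `2 = -1` makes `-1 - A` a
  -- Hermitian matrix of rank one.
  have ht : A.trace * (A.trace - 2) = 0 := by
    rw [trace_fin_three]
    linear_combination k0 + k1 + k2 + three_eq_zero + 2 * e00 + 2 * e11 + 2 * e22
  have hadj1 : adjugate (1 + A) = (1 + A.trace) • (1 : Matrix (Fin 3) (Fin 3) F9) := by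
    have : adjugate (1 + A) =
        (1 + A.trace) • (1 : Matrix (Fin 3) (Fin 3) F9) - A + adjugate A := by
      ext1 i j
      fin_cases i <;> fin_cases j <;>
      simp [adjugate_fin_three, trace_fin_three, one_apply] <;> ring
    rw [this, hadj, sub_add_cancel]
  rcases mul_eq_zero.1 ht with h | h
  · left
    have h1 := mul_adjugate (1 + A)
    rw [hadj1, h, add_zero, one_smul, mul_one] at h1
    obtain ⟨c, hc⟩ : ∃ c : F9, A = c • 1 :=
      ⟨(1 + A).det - 1, by rw [sub_smul, ← h1, one_smul, add_sub_cancel_left]⟩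
    rw [hc] at k0 hdet
    simp only [Matrix.smul_apply, one_apply, smul_eq_mul, if_true, mul_one] at k0
    rw [det_smul, det_one, mul_one, Fintype.card_fin] at hdet
    have hc1 : c = 1 := by
      have : c * c = 1 := by simpa using k0
      linear_combination hdet - c * this
    exact Subtype.ext (by rw [← hA, hc, hc1, one_smul]; rfl)
  · right
    have ht' : A.trace = -1 := by linear_combination h + three_eq_zero
    rw [ht', add_neg_cancel, zero_smul] at hadj1
    obtain ⟨E, hE⟩ : ∃ E, E = -1 - A := ⟨_, rfl⟩
    have hAE : A = -1 - E := by rw [hE]; abel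
    have hadjE : adjugate E = 0 := by
      rw [hE, show -1 - A = (-1 : F9) • (1 + A) by rw [neg_one_smul]; abel, adjugate_smul, hadj1,
        smul_zero]
    have hES : ∀ i j, star (E i j) = E j i := fun i j => by
      have : star E = E := by rw [hE, star_sub, star_neg, star_one, hS]
      conv_rhs => rw [← this]
      rfl
    have htr : E 0 0 + E 1 1 + E 2 2 = 1 := by
      rw [← trace_fin_three, hE, trace_sub, ht', trace_neg, trace_one, Fintype.card_fin]
      norm_num
      linear_combination -three_eq_zero
    have hm : ∀ i j, adjugate E i j = 0 := fun i j => by rw [hadjE]; rfl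
    have hrank : ∀ i j k, E i k * E j j = E i j * E j k := by
      have m00 := hm 0 0
      have m01 := hm 0 1
      have m02 := hm 0 2
      have m10 := hm 1 0
      have m11 := hm 1 1
      have m12 := hm 1 2
      have m20 := hm 2 0
      have m21 := hm 2 1
      have m22 := hm 2 2
      simp only [adjugate_fin_three, of_apply, cons_val', cons_val_zero, cons_val_one, cons_val,
        cons_val_fin_one] at m00 m01 m02 m10 m11 m12 m20 m21 m22
      intro i j k
      fin_cases i <;> fin_cases j <;> fin_cases k <;>
      simp only [Fin.zero_eta, Fin.mk_one, Fin.reduceFinMk] <;>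
      first
        | ring1
        | linear_combination m00
        | linear_combination -m00
        | linear_combination m01
        | linear_combination -m01
        | linear_combination m02
        | linear_combination -m02
        | linear_combination m10
        | linear_combination -m10
        | linear_combination m11
        | linear_combination -m11
        | linear_combination m12
        | linear_combination -m12
        | linear_combination m20
        | linear_combination -m20
        | linear_combination m21
        | linear_combination -m21
        | linear_combination m22
    obtain ⟨j, hj⟩ : ∃ j, E j j ≠ 0 := by
      by_contra! hcon
      rw [hcon, hcon, hcon] at htr
      exact absurd htr (by decide)
    -- The norm from `𝔽₉ˣ` to `𝔽₃ˣ` is onto, and `E j j` is fixed by conjugation. Column `j` divided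
    -- by `m` is then the vector `v` with `E = v v*`.
    obtain ⟨m, hm0, hm⟩ : ∃ m : F9, m ≠ 0 ∧ m * star m = E j j := by
      have h2 := hES j j
      revert h2 hj
      generalize E j j = x
      obtain ⟨b, c⟩ := x
      intro hj h2
      have : ∀ b c : ZMod 3, (⟨b, c⟩ : F9) ≠ 0 → star (⟨b, c⟩ : F9) = ⟨b, c⟩ →
        ∃ p q : ZMod 3, (⟨p, q⟩ : F9) ≠ 0 ∧ (⟨p, q⟩ : F9) * star ⟨p, q⟩ = ⟨b, c⟩ := by decide
      obtain ⟨p, q, h, h'⟩ := this b c hj h2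
      exact ⟨_, h, h'⟩
    have hEv : ∀ i k, E i k = E i j / m * star (E k j / m) := fun i k => by
      have h1 : star m ≠ 0 := (star_ne_zero).2 hm0
      rw [star_div₀, hES]
      field_simp
      rw [mul_assoc, mul_comm m, mul_comm (star m) m, hm, hrank]
    refine ⟨fun i => E i j / m, ?_, Subtype.ext ?_⟩
    · simp only [dotProduct, Fin.sum_univ_three, Pi.star_apply]
      rw [← htr, hEv 0 0, hEv 1 1, hEv 2 2]
      ring
    · rw [coe_invol]
      · rw [← hA, hAE, reflMatrix]
        congr 1
        ext1 i k
        rw [hEv]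
        rfl
      · simp only [dotProduct, Fin.sum_univ_three, Pi.star_apply]
        rw [← htr, hEv 0 0, hEv 1 1, hEv 2 2]
        ring

/-! ### Vectors over `𝔽₉` as natural numbers

The element `a + b i` of `𝔽₉` is encoded as `a + 3 b`, and a vector as a number with three digits in
base `9`. -/

/-- `force n k = k n`, but the kernel evaluates `n` before it unfolds `k`. -/
def force {α : Type} (n : ℕ) (k : ℕ → α) : α := Nat.rec (k 0) (fun m _ => k (m + 1)) n

theorem force_eq {α : Type} (n : ℕ) (k : ℕ → α) : force n k = k n := by cases n <;> rfl

/-- The element of `𝔽₉` with a given code. -/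
def toF (n : ℕ) : F9 := ⟨n, (n / 3 : ℕ)⟩

/-- Addition of codes. -/
def addCode (a b : ℕ) : ℕ := (a + b) % 3 + 3 * ((a / 3 + b / 3) % 3)

/-- Multiplication of codes. -/
def mulCode (a b : ℕ) : ℕ :=
  (a * b + 2 * ((a / 3) * (b / 3))) % 3 + 3 * ((a * (b / 3) + (a / 3) * b) % 3)

/-- Conjugation of codes. -/
def starCode (a : ℕ) : ℕ := a % 3 + 3 * (2 * (a / 3) % 3)

/-- The code of the vector with given codes of the coordinates. -/
def vecCode (a b c : ℕ) : ℕ := a + 9 * b + 81 * c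

/-- The code of the Hermitian product of two vectors. -/
def innerCode (v w : ℕ) : ℕ :=
  addCode (addCode (mulCode (starCode (v % 9)) (w % 9))
    (mulCode (starCode (v / 9 % 9)) (w / 9 % 9))) (mulCode (starCode (v / 81 % 9)) (w / 81 % 9))

/-- The code of the image of `w` under the involution with fixed vector `v`. -/
def reflCode (v w : ℕ) : ℕ :=
  force (innerCode v w) fun t => vecCode
    (mulCode 2 (addCode (w % 9) (mulCode t (v % 9))))
    (mulCode 2 (addCode (w / 9 % 9) (mulCode t (v / 9 % 9))))
    (mulCode 2 (addCode (w / 81 % 9) (mulCode t (v / 81 % 9))))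

/-- The code of a scalar multiple of a vector. -/
def smulCode (l v : ℕ) : ℕ :=
  vecCode (mulCode l (v % 9)) (mulCode l (v / 9 % 9)) (mulCode l (v / 81 % 9))

/-- The first non-zero coordinate. -/
def leadCode (n : ℕ) : ℕ :=
  bif Nat.beq (n % 9) 0 then bif Nat.beq (n / 9 % 9) 0 then n / 81 % 9 else n / 9 % 9 else n % 9

/-- The scalar of norm `1` whose product with a given non-zero `f` is `1` or `1 + i`. -/
def phaseCode (f : ℕ) : ℕ := 233616211 / 10 ^ (f % 9) % 10

/-- The scalar multiple of a vector, by a scalar of norm `1`, with first non-zero coordinate `1` or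
`1 + i`. -/
def canonCode (n : ℕ) : ℕ := smulCode (phaseCode (leadCode n)) n

/-- The action of the involutions on normalised vectors. -/
def actCode (c d : ℕ) : ℕ := force (reflCode c d) canonCode

/-- The normalised vectors of norm `1`. -/
def lines : List ℕ :=
  (List.range 729).filter fun n => Nat.beq (innerCode n n) 1 && Nat.beq (canonCode n) n

/-- The vector with a given code. -/
def toV (n : ℕ) : Fin 3 → F9 := ![toF (n % 9), toF (n / 9 % 9), toF (n / 81 % 9)]

/-! ### Correctness of the codes -/

theorem toF_mod_add (x y : ℕ) : toF (x % 3 + 3 * y) = ⟨x, y⟩ := by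
  have h : (x % 3 + 3 * y) / 3 = y := by omega
  have h3 : (3 : ZMod 3) = 0 := by decide
  rw [toF, h]
  ext
  · simp [h3]
  · rfl

theorem toF_addCode (a b : ℕ) : toF (addCode a b) = toF a + toF b := by
  rw [addCode, toF_mod_add]
  ext <;> simp [toF]

theorem toF_mulCode (a b : ℕ) : toF (mulCode a b) = toF a * toF b := by
  have h2 : (2 : ZMod 3) = -1 := by decide
  rw [mulCode, toF_mod_add]
  ext
  · simp [toF, h2]
  · simp [toF]

theorem toF_starCode (a : ℕ) : toF (starCode a) = star (toF a) := by
  have h2 : (2 : ZMod 3) = -1 := by decide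
  rw [starCode, toF_mod_add]
  ext
  · simp [toF]
  · simp [toF, h2]

theorem toF_two : toF 2 = -1 := by decide

theorem toF_injOn : ∀ a < 9, ∀ b < 9, toF a = toF b → a = b := by decide

theorem toF_surj (x : F9) : ∃ a < 9, toF a = x := by
  obtain ⟨a, b⟩ := x
  revert a b
  decide

theorem mulCode_lt (a b : ℕ) : mulCode a b < 9 := by
  have h1 := Nat.mod_lt (a * b + 2 * ((a / 3) * (b / 3))) (show 0 < 3 by norm_num)
  have h2 := Nat.mod_lt (a * (b / 3) + (a / 3) * b) (show 0 < 3 by norm_num)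
  rw [mulCode]
  omega

theorem toV_vecCode {a b c : ℕ} (ha : a < 9) (hb : b < 9) (hc : c < 9) :
    toV (vecCode a b c) = ![toF a, toF b, toF c] := by
  have h1 : (a + 9 * b + 81 * c) % 9 = a := by omega
  have h2 : (a + 9 * b + 81 * c) / 9 % 9 = b := by omega
  have h3 : (a + 9 * b + 81 * c) / 81 % 9 = c := by omega
  rw [vecCode, toV, h1, h2, h3]

theorem vecCode_lt {a b c : ℕ} (ha : a < 9) (hb : b < 9) (hc : c < 9) : vecCode a b c < 729 := by
  rw [vecCode]
  omega

theorem toV_injOn {m n : ℕ} (hm : m < 729) (hn : n < 729) (h : toV m = toV n) : m = n := by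
  have h0 := toF_injOn _ (Nat.mod_lt m (by norm_num)) _ (Nat.mod_lt n (by norm_num)) (congrFun h 0)
  have h1 := toF_injOn _ (Nat.mod_lt (m / 9) (by norm_num)) _ (Nat.mod_lt (n / 9) (by norm_num))
    (congrFun h 1)
  have h2 := toF_injOn _ (Nat.mod_lt (m / 81) (by norm_num)) _ (Nat.mod_lt (n / 81) (by norm_num))
    (congrFun h 2)
  omega

theorem toV_surj (v : Fin 3 → F9) : ∃ n < 729, toV n = v := by
  obtain ⟨a, ha, ha'⟩ := toF_surj (v 0)
  obtain ⟨b, hb, hb'⟩ := toF_surj (v 1)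
  obtain ⟨c, hc, hc'⟩ := toF_surj (v 2)
  refine ⟨vecCode a b c, vecCode_lt ha hb hc, ?_⟩
  rw [toV_vecCode ha hb hc, ha', hb', hc']
  ext i : 1
  fin_cases i <;> rfl

theorem toF_innerCode (v w : ℕ) : toF (innerCode v w) = star (toV v) ⬝ᵥ toV w := by
  simp only [innerCode, toF_addCode, toF_mulCode, toF_starCode, dotProduct, Fin.sum_univ_three]
  rfl

theorem toV_smulCode (l v : ℕ) : toV (smulCode l v) = toF l • toV v := by
  rw [smulCode, toV_vecCode (mulCode_lt _ _) (mulCode_lt _ _) (mulCode_lt _ _), toF_mulCode,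
    toF_mulCode, toF_mulCode]
  ext i : 1
  fin_cases i <;> rfl

theorem smulCode_lt (l v : ℕ) : smulCode l v < 729 :=
  vecCode_lt (mulCode_lt _ _) (mulCode_lt _ _) (mulCode_lt _ _)

theorem reflCode_lt (v w : ℕ) : reflCode v w < 729 := by
  rw [reflCode, force_eq]
  exact vecCode_lt (mulCode_lt _ _) (mulCode_lt _ _) (mulCode_lt _ _)

theorem toV_reflCode (v w : ℕ) : toV (reflCode v w) = reflMatrix (toV v) *ᵥ toV w := by
  rw [reflCode, force_eq, toV_vecCode (mulCode_lt _ _) (mulCode_lt _ _) (mulCode_lt _ _),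
    reflMatrix_mulVec]
  simp only [toF_addCode, toF_mulCode, toF_two, toF_innerCode, neg_one_mul]
  ext i : 1
  fin_cases i <;> rfl

/-- The decimal digits of 233616211, read from the units upwards, tabulate the scalars for the codes
`0` to `8`; only the digits `1, 2, 3, 6`, the codes of `1, -1, i, -i`, occur. -/
theorem phaseCode_norm (f : ℕ) : star (toF (phaseCode f)) * toF (phaseCode f) = 1 := by
  have h : ∀ r < 9, star (toF (233616211 / 10 ^ r % 10)) * toF (233616211 / 10 ^ r % 10) = 1 := by
    decide
  exact h _ (Nat.mod_lt f (by norm_num))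

theorem exists_toV_actCode (c d : ℕ) : ∃ l : F9, star l * l = 1 ∧
    toV (actCode c d) = l • reflMatrix (toV c) *ᵥ toV d := by
  rw [actCode, force_eq, canonCode, toV_smulCode, toV_reflCode]
  exact ⟨_, phaseCode_norm _, rfl⟩

theorem mem_lines_iff {n : ℕ} :
    n ∈ lines ↔ n < 729 ∧ innerCode n n = 1 ∧ canonCode n = n := by
  rw [lines, List.mem_filter, List.mem_range, Bool.and_eq_true, Nat.beq_eq, Nat.beq_eq]

theorem norm_eq_one_of_innerCode {n : ℕ} (h : innerCode n n = 1) :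
    star (toV n) ⬝ᵥ toV n = 1 := by
  rw [← toF_innerCode, h]
  decide

/-- There are 63 codes, one for each non-isotropic point. The explicit list spares later kernel
computations the filtering of all 729 vectors. -/
theorem lines_eq : lines = [1, 9, 40, 49, 67, 76, 81, 94, 103, 112, 118, 127, 139, 145, 154, 175,
    184, 193, 199, 208, 220, 226, 235, 256, 265, 274, 280, 289, 301, 307, 316, 328, 334, 343, 352,
    360, 379, 409, 415, 424, 433, 441, 460, 499, 508, 517, 523, 532, 544, 550, 559, 571, 577, 586,
    595, 603, 622, 652, 658, 667, 676, 684, 703] := by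
  decide +kernel

/-! ### Words in the involutions -/

/-- The involutions of `SU₃(3)` in terms of codes. -/
def codeInvol (n : ℕ) : SU33 := invol (toV n)

/-- The element of `SU₃(3)` given by a word in the involutions. -/
def wordElt : List ℕ → SU33
  | [] => 1
  | c :: w => codeInvol c * wordElt w

/-- The action of a word in the involutions on normalised vectors. -/
def wordAct : List ℕ → ℕ → ℕ
  | [], d => d
  | c :: w, d => force (wordAct w d) (actCode c)

/-- The action of a word in the involutions on vectors. -/
def wordVec : List ℕ → ℕ → ℕ
  | [], d => d
  | c :: w, d => force (wordVec w d) (reflCode c)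

/-- All letters of a word have norm `1`. -/
def IsWord (w : List ℕ) : Prop := ∀ c ∈ w, innerCode c c = 1

instance (w : List ℕ) : Decidable (IsWord w) := by unfold IsWord; infer_instance

theorem coe_codeInvol {c : ℕ} (hc : innerCode c c = 1) :
    (codeInvol c).1 = reflMatrix (toV c) :=
  coe_invol (norm_eq_one_of_innerCode hc)

theorem codeInvol_mul_self (c : ℕ) : codeInvol c * codeInvol c = 1 := invol_mul_self _

theorem codeInvol_inv (c : ℕ) : (codeInvol c)⁻¹ = codeInvol c := invol_inv _

theorem wordElt_conj {w : List ℕ} (hw : IsWord w) (d : ℕ) :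
    wordElt w * codeInvol d * (wordElt w)⁻¹ = codeInvol (wordAct w d) := by
  induction w with
  | nil => simp [wordElt, wordAct]
  | cons c w ih =>
    have ih := ih fun e he => hw e (List.mem_cons_of_mem _ he)
    obtain ⟨l, hl, h⟩ := exists_toV_actCode c (wordAct w d)
    rw [wordAct, force_eq, codeInvol.eq_def (actCode _ _), h, invol_smul hl, ← coe_codeInvol (hw c List.mem_cons_self),
      ← conj_invol, ← codeInvol, ← ih, wordElt]
    group

theorem wordElt_append (u w : List ℕ) : wordElt (u ++ w) = wordElt u * wordElt w := by
  induction u with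
  | nil => simp [wordElt]
  | cons c u ih => simp [wordElt, ih, mul_assoc]

theorem wordElt_reverse (w : List ℕ) : wordElt w.reverse = (wordElt w)⁻¹ := by
  induction w with
  | nil => simp [wordElt]
  | cons c w ih => simp [wordElt, wordElt_append, ih, codeInvol_inv]

theorem toV_wordVec {w : List ℕ} (hw : IsWord w) (d : ℕ) :
    toV (wordVec w d) = (wordElt w).1 *ᵥ toV d := by
  induction w with
  | nil => simp [wordElt, wordVec]
  | cons c w ih =>
    have ih := ih fun e he => hw e (List.mem_cons_of_mem _ he)
    rw [wordVec, force_eq, toV_reflCode, ← coe_codeInvol (hw c List.mem_cons_self), ih,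
      mulVec_mulVec]
    rfl

theorem wordVec_lt {w : List ℕ} {d : ℕ} (hd : d < 729) : wordVec w d < 729 := by
  cases w with
  | nil => exact hd
  | cons c w =>
    rw [wordVec, force_eq]
    exact reflCode_lt _ _

theorem toV_one : toV 1 = Pi.single 0 1 := by decide
theorem toV_nine : toV 9 = Pi.single 1 1 := by decide
theorem toV_eightyOne : toV 81 = Pi.single 2 1 := by decide

/-- The codes `1`, `9`, `81` are those of the standard basis, which determines a matrix. Here
`wordVec` is used because `wordAct` forgets scalars of norm `1`. -/
theorem wordElt_eq_one_iff {w : List ℕ} (hw : IsWord w) :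
    wordElt w = 1 ↔ wordVec w 1 = 1 ∧ wordVec w 9 = 9 ∧ wordVec w 81 = 81 := by
  constructor
  · intro h
    have key : ∀ d < 729, wordVec w d = d := fun d hd => by
      apply toV_injOn (wordVec_lt hd) hd
      rw [toV_wordVec hw, h]
      exact one_mulVec _
    exact ⟨key _ (by norm_num), key _ (by norm_num), key _ (by norm_num)⟩
  · rintro ⟨h1, h2, h3⟩
    have key : ∀ d, wordVec w d = d → (wordElt w).1 *ᵥ toV d = toV d := fun d hd => by
      rw [← toV_wordVec hw, hd]
    have k1 := key _ h1
    have k2 := key _ h2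
    have k3 := key _ h3
    rw [toV_one, mulVec_single_one] at k1
    rw [toV_nine, mulVec_single_one] at k2
    rw [toV_eightyOne, mulVec_single_one] at k3
    apply Subtype.ext
    ext1 i j
    have : (wordElt w).1.col j i = (Pi.single j 1 : Fin 3 → F9) i := by
      fin_cases j
      · exact congrFun k1 i
      · exact congrFun k2 i
      · exact congrFun k3 i
    rw [col_apply] at this
    rw [this, Submonoid.coe_one, one_apply, Pi.single_apply]

theorem exists_mem_lines {v : Fin 3 → F9} (hv : star v ⬝ᵥ v = 1) :
    ∃ c ∈ lines, ∃ l : F9, star l * l = 1 ∧ toV c = l • v := by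
  obtain ⟨n, hn, rfl⟩ := toV_surj v
  have hn1 : innerCode n n = 1 := by
    refine toF_injOn _ ?_ _ (by norm_num) ?_
    · simp only [innerCode, addCode]
      omega
    · rw [toF_innerCode, hv]
      decide
  have key : ∀ n ∈ List.range 729, (!Nat.beq (innerCode n n) 1 ||
      force (canonCode n) fun m => lines.any (Nat.beq m)) = true := by
    rw [lines_eq, ← List.all_eq_true]
    decide +kernel
  have h := key n (List.mem_range.2 hn)
  rw [hn1, force_eq] at h
  simp only [Nat.beq_refl, Bool.not_true, Bool.false_or, List.any_eq_true, Nat.beq_eq] at h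
  obtain ⟨c, hc, h⟩ := h
  refine ⟨c, hc, _, phaseCode_norm (leadCode n), ?_⟩
  rw [← toV_smulCode, ← h, canonCode]

theorem eq_one_or_eq_codeInvol {a : SU33} (ha : a ^ 2 = 1) :
    a = 1 ∨ ∃ c ∈ lines, a = codeInvol c := by
  rcases eq_one_or_eq_invol ha with h | ⟨v, hv, rfl⟩
  · exact Or.inl h
  · obtain ⟨c, hc, l, hl, h⟩ := exists_mem_lines hv
    exact Or.inr ⟨c, hc, by rw [codeInvol, h, invol_smul hl]⟩

/-- Equal involutions have proportional vectors, with the inner product as factor, and the kernel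
checks on all pairs of codes that normalised proportional vectors coincide. -/
theorem codeInvol_injOn {c d : ℕ} (hc : c ∈ lines) (hd : d ∈ lines)
    (h : codeInvol c = codeInvol d) : c = d := by
  have hc' := mem_lines_iff.1 hc
  have hd' := mem_lines_iff.1 hd
  have h1 := eq_smul_of_invol_eq (norm_eq_one_of_innerCode hc'.2.1)
    (norm_eq_one_of_innerCode hd'.2.1) h
  rw [← toF_innerCode, ← toV_smulCode] at h1
  have h2 := toV_injOn hd'.1 (smulCode_lt _ _) h1
  have key : ∀ c ∈ lines, ∀ d ∈ lines, (!force (innerCode c d) (fun t =>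
      Nat.beq d (smulCode t c)) || Nat.beq c d) = true := by
    simp_rw [lines_eq, ← List.all_eq_true]
    decide +kernel
  have h3 := key c hc d hd
  rw [force_eq, ← h2] at h3
  simpa using h3

/-! ### Orbits on normalised vectors -/

/-- Computes the orbit of the given words on normalised vectors and passes it to `k`; here `fr` is
the list of points whose images have not been computed yet and `s` is the list of all points found
so far. -/
def orbit (ws : List (List ℕ)) (k : List ℕ → Bool) : ℕ → List ℕ → List ℕ → Bool
  | 0, _, s => k s
  | _ + 1, [], s => k s
  | n + 1, x :: fr, s =>
    ws.foldr (fun w rec fr s => force (wordAct w x) fun y =>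
      bif s.any (Nat.beq y) then rec fr s else rec (y :: fr) (y :: s)) (orbit ws k n) fr s

/-- The list handed to `k` contains the seeds and lies in every set that contains the seeds and is
closed under the words. Nothing says that it is closed itself, so soundness does not depend on the
fuel `n`; a test `k` that needs closure has to check it. -/
theorem orbit_spec {ws : List (List ℕ)} {k : List ℕ → Bool} {n : ℕ} {fr s : List ℕ}
    (h : orbit ws k n fr s = true) : ∃ t, k t = true ∧ s ⊆ t ∧
      ∀ P : ℕ → Prop, (∀ w ∈ ws, ∀ x, P x → P (wordAct w x)) → (∀ x ∈ fr, P x) →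
        (∀ x ∈ s, P x) → ∀ x ∈ t, P x := by
  induction n generalizing fr s with
  | zero => exact ⟨s, h, List.Subset.refl s, fun P _ _ hs => hs⟩
  | succ n ih =>
    cases fr with
    | nil => exact ⟨s, h, List.Subset.refl s, fun P _ _ hs => hs⟩
    | cons x fr =>
      rw [orbit] at h
      -- The fold treats the words one at a time, so the induction is over the words `vs` still to
      -- be applied to `x`, with both lists general.
      suffices key : ∀ vs : List (List ℕ), ∀ fr s,
          vs.foldr (fun w rec fr s => force (wordAct w x) fun y =>
            bif s.any (Nat.beq y) then rec fr s else rec (y :: fr) (y :: s))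
            (orbit ws k n) fr s = true → ∃ t, k t = true ∧ s ⊆ t ∧
              ∀ P : ℕ → Prop, (∀ w ∈ ws, ∀ x, P x → P (wordAct w x)) → (∀ x ∈ fr, P x) →
              (∀ w ∈ vs, P (wordAct w x)) → (∀ x ∈ s, P x) → ∀ x ∈ t, P x by
        obtain ⟨t, h1, h2, h3⟩ := key ws fr s h
        exact ⟨t, h1, h2, fun P hP hfr hs => h3 P hP
          (fun y hy => hfr y (List.mem_cons_of_mem _ hy))
          (fun w hw => hP w hw x (hfr x List.mem_cons_self)) hs⟩
      intro vs
      induction vs with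
      | nil =>
        intro fr s h
        obtain ⟨t, h1, h2, h3⟩ := ih h
        exact ⟨t, h1, h2, fun P hP hfr _ hs => h3 P hP hfr hs⟩
      | cons w vs ihv =>
        intro fr s h
        rw [List.foldr_cons, force_eq] at h
        cases hb : s.any (Nat.beq (wordAct w x)) with
        | true =>
          rw [hb, cond_true] at h
          obtain ⟨t, h1, h2, h3⟩ := ihv _ _ h
          exact ⟨t, h1, h2, fun P hP hfr hv hs => h3 P hP hfr
            (fun u hu => hv u (List.mem_cons_of_mem _ hu)) hs⟩
        | false =>
          rw [hb, cond_false] at h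
          obtain ⟨t, h1, h2, h3⟩ := ihv _ _ h
          refine ⟨t, h1, fun y hy => h2 (List.mem_cons_of_mem _ hy), fun P hP hfr hv hs =>
            h3 P hP ?_ (fun u hu => hv u (List.mem_cons_of_mem _ hu)) ?_⟩
          · exact List.forall_mem_cons.2 ⟨hv w List.mem_cons_self, hfr⟩
          · exact List.forall_mem_cons.2 ⟨hv w List.mem_cons_self, hs⟩

/-- Every normalised vector of norm `1` satisfying `p` is in the orbit of one of the given vectors
under the given words. -/
def orbitCovers (ws : List (List ℕ)) (p : ℕ → Bool) (s : List ℕ) : Bool :=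
  orbit ws (fun t => lines.all fun d => !p d || t.any (Nat.beq d)) 200 s s

theorem orbitCovers_spec {ws : List (List ℕ)} {p : ℕ → Bool} {s : List ℕ}
    (h : orbitCovers ws p s = true) {P : ℕ → Prop}
    (hP : ∀ w ∈ ws, ∀ x, P x → P (wordAct w x)) (hs : ∀ x ∈ s, P x) {d : ℕ} (hd : d ∈ lines)
    (hpd : p d = true) : P d := by
  obtain ⟨t, h1, -, h3⟩ := orbit_spec h
  have h := List.all_eq_true.1 h1 d hd
  simp only [hpd, Bool.not_true, Bool.false_or, List.any_eq_true, Nat.beq_eq] at h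
  obtain ⟨e, he, rfl⟩ := h
  exact h3 P hP hs hs d he

theorem wordAct_append (u w : List ℕ) (d : ℕ) : wordAct (u ++ w) d = wordAct u (wordAct w d) := by
  induction u with
  | nil => rfl
  | cons c u ih => rw [List.cons_append, wordAct, wordAct, ih]

/-- The norm is kept because the action is unitary up to a scalar of norm `1`; normalisation is kept
because `canonCode` is idempotent, which is checked on all codes. -/
theorem mem_lines_actCode {c d : ℕ} (hc : innerCode c c = 1) (hd : d ∈ lines) :
    actCode c d ∈ lines := by
  have key : ∀ n ∈ List.range 729, Nat.beq (canonCode n) (force (canonCode n) canonCode) = true := by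
    rw [← List.all_eq_true]
    decide +kernel
  rw [mem_lines_iff]
  refine ⟨?_, ?_, ?_⟩
  · rw [actCode, force_eq]
    exact smulCode_lt _ _
  · refine toF_injOn _ ?_ _ (by norm_num) ?_
    · simp only [innerCode, addCode]
      omega
    · obtain ⟨l, hl, h⟩ := exists_toV_actCode c d
      rw [toF_innerCode, h, ← coe_codeInvol hc, ← mulVec_smul, star_mulVec_dotProduct, star_smul,
        smul_dotProduct, dotProduct_smul, smul_smul, hl, one_smul,
        norm_eq_one_of_innerCode (mem_lines_iff.1 hd).2.1]
      decide
  · have h := key (reflCode c d) (List.mem_range.2 (reflCode_lt _ _))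
    rw [force_eq, Nat.beq_eq] at h
    rw [actCode, force_eq, ← h]

theorem mem_lines_wordAct {w : List ℕ} (hw : IsWord w) {d : ℕ} (hd : d ∈ lines) :
    wordAct w d ∈ lines := by
  induction w with
  | nil => exact hd
  | cons c w ih =>
    rw [wordAct, force_eq]
    exact mem_lines_actCode (hw c List.mem_cons_self)
      (ih fun e he => hw e (List.mem_cons_of_mem _ he))

theorem one_mem_lines : 1 ∈ lines := by rw [lines_eq]; decide
theorem nine_mem_lines : 9 ∈ lines := by rw [lines_eq]; decide

/-- Four involutions are already transitive on the 63 points; hence all involutions are conjugate.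
-/
theorem exists_wordAct_eq {d : ℕ} (hd : d ∈ lines) : ∃ w, IsWord w ∧ wordAct w 1 = d := by
  have h : orbitCovers [[1], [9], [307], [235]] (fun _ => true) [1] = true := by
    rw [orbitCovers, lines_eq]
    decide +kernel
  refine orbitCovers_spec (P := fun d => ∃ w, IsWord w ∧ wordAct w 1 = d) h ?_ ?_ hd rfl
  · rintro u hu x ⟨w, hw, rfl⟩
    have hu' : IsWord u := by
      revert u
      decide
    refine ⟨u ++ w, fun c hc => ?_, wordAct_append u w 1⟩
    rcases List.mem_append.1 hc with hc | hc
    · exact hu' c hc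
    · exact hw c hc
  · intro x hx
    rw [List.mem_singleton.1 hx]
    exact ⟨[], by simp [IsWord], rfl⟩

/-- In characteristic three the identity has trace `0` and the involution has trace `-1`. -/
theorem codeInvol_ne_one {c : ℕ} (hc : innerCode c c = 1) : codeInvol c ≠ 1 := by
  intro h
  have h1 := coe_codeInvol hc
  rw [h] at h1
  have h2 := congrArg trace h1
  have h3 := norm_eq_one_of_innerCode hc
  rw [dotProduct_comm] at h3
  rw [reflMatrix, trace_sub, trace_neg, trace_vecMulVec, h3, Submonoid.coe_one, trace_one,
    Fintype.card_fin] at h2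
  revert h2
  decide

/-- The conjugates of the involutions are involutions. -/
theorem exists_conj_codeInvol (g : SU33) {c : ℕ} (hc : innerCode c c = 1) :
    ∃ d ∈ lines, g * codeInvol c * g⁻¹ = codeInvol d := by
  have h : (g * codeInvol c * g⁻¹) ^ 2 = 1 := by
    rw [conj_pow, pow_two, codeInvol_mul_self, mul_one, mul_inv_cancel]
  refine (eq_one_or_eq_codeInvol h).resolve_left fun h => codeInvol_ne_one hc ?_
  rwa [conj_eq_one_iff] at h

/-! ### `SU₃(3)` is generated by involutions -/

/-- The words which permute the six lines orthogonal to the first coordinate axis transitively. -/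
def stabWords : List (List ℕ) := [[360], [499, 112], [544, 94]]

theorem isWord_of_mem_stabWords : ∀ w ∈ stabWords, IsWord w := by decide

theorem conj_codeInvol_one_of_mem_stabWords {w : List ℕ} (hw : w ∈ stabWords) :
    wordElt w * codeInvol 1 * (wordElt w)⁻¹ = codeInvol 1 := by
  rw [wordElt_conj (isWord_of_mem_stabWords w hw)]
  have : ∀ w ∈ stabWords, wordAct w 1 = 1 := by decide +kernel
  rw [this w hw]

theorem coe_codeInvol_one : (codeInvol 1).1 = diagonal ![1, -1, -1] := by
  rw [coe_codeInvol (mem_lines_iff.1 one_mem_lines).2.1]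
  decide

theorem coe_codeInvol_nine : (codeInvol 9).1 = diagonal ![-1, 1, -1] := by
  rw [coe_codeInvol (mem_lines_iff.1 nine_mem_lines).2.1]
  decide

/-- The matrices `diag(1,-1,-1)` and `diag(-1,1,-1)` together separate the three coordinates, so
each off-diagonal entry of `g` equals its own negative. -/
theorem eq_diagonal {g : SU33} (h1 : g * codeInvol 1 = codeInvol 1 * g)
    (h9 : g * codeInvol 9 = codeInvol 9 * g) : g.1 = diagonal fun i => g.1 i i := by
  have h1' := congrArg Subtype.val h1
  have h9' := congrArg Subtype.val h9
  rw [Submonoid.coe_mul, Submonoid.coe_mul, coe_codeInvol_one] at h1'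
  rw [Submonoid.coe_mul, Submonoid.coe_mul, coe_codeInvol_nine] at h9'
  have key : ∀ x : F9, x = -x → x = 0 := fun x hx => by
    linear_combination (-1 : F9) * hx + x * three_eq_zero
  ext1 i j
  have k1 := congrFun (congrFun h1' i) j
  have k9 := congrFun (congrFun h9' i) j
  rw [mul_diagonal, diagonal_mul] at k1 k9
  fin_cases i <;> fin_cases j <;> simp at k1 k9 ⊢ <;>
  first
    | exact key _ k1
    | exact key _ k1.symm
    | exact key _ k9
    | exact key _ k9.symm

/-- The involutions which interchange the first two coordinate axes. -/
def swapFst (b : F9) (hb : star b * b = 1) : SU33 :=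
  ⟨!![0, b, 0; star b, 0, 0; 0, 0, -1], by
    rw [mem_specialUnitaryGroup_iff, mem_unitaryGroup_iff]
    constructor
    · ext1 i j
      fin_cases i <;> fin_cases j <;>
      simp [mul_apply, Fin.sum_univ_three, hb, mul_comm b]
    · simp [det_fin_three, mul_comm b, hb]⟩

/-- The involutions which interchange the last two coordinate axes. -/
def swapSnd (b : F9) (hb : star b * b = 1) : SU33 :=
  ⟨!![-1, 0, 0; 0, 0, b; 0, star b, 0], by
    rw [mem_specialUnitaryGroup_iff, mem_unitaryGroup_iff]
    constructor
    · ext1 i j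
      fin_cases i <;> fin_cases j <;>
      simp [mul_apply, Fin.sum_univ_three, hb, mul_comm b]
    · simp [det_fin_three, mul_comm b, hb]⟩

theorem swapFst_sq (b : F9) (hb : star b * b = 1) : swapFst b hb ^ 2 = 1 := by
  apply Subtype.ext
  rw [pow_two]
  change !![0, b, 0; star b, 0, 0; 0, 0, -1] * !![0, b, 0; star b, 0, 0; 0, 0, -1] = 1
  ext1 i j
  fin_cases i <;> fin_cases j <;> simp [mul_apply, Fin.sum_univ_three, hb, mul_comm b]

theorem swapSnd_sq (b : F9) (hb : star b * b = 1) : swapSnd b hb ^ 2 = 1 := by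
  apply Subtype.ext
  rw [pow_two]
  change !![-1, 0, 0; 0, 0, b; 0, star b, 0] * !![-1, 0, 0; 0, 0, b; 0, star b, 0] = 1
  ext1 i j
  fin_cases i <;> fin_cases j <;> simp [mul_apply, Fin.sum_univ_three, hb, mul_comm b]

theorem star_one_mul_one : star (1 : F9) * 1 = 1 := by rw [star_one, one_mul]

/-- The matrix factors as `diag(a, ā, 1) · diag(1, b, b̄)` with `a = x₀`, `b = x₀ x₁`, and each
factor is a product of two involutions that swap coordinate axes. -/
theorem eq_mul_of_eq_diagonal {g : SU33} {x : Fin 3 → F9} (hg : g.1 = diagonal x) :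
    ∃ (a b : F9) (ha : star a * a = 1) (hb : star b * b = 1),
      g = swapFst a ha * swapFst 1 star_one_mul_one *
        (swapSnd b hb * swapSnd 1 star_one_mul_one) := by
  have hu := coe_star_mul_coe g
  rw [hg, star_eq_conjTranspose, diagonal_conjTranspose, diagonal_mul_diagonal, ← diagonal_one,
    diagonal_eq_diagonal_iff] at hu
  have hd := det_coe g
  rw [hg, det_diagonal, Fin.prod_univ_three] at hd
  have h0 := hu 0
  have h1 := hu 1
  simp only [Pi.star_apply] at h0 h1
  have hb : star (x 0 * x 1) * (x 0 * x 1) = 1 := by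
    rw [star_mul]
    linear_combination star (x 1) * x 1 * h0 + h1
  have h2 : x 2 = star (x 0 * x 1) := by
    linear_combination star (x 0 * x 1) * hd - x 2 * hb
  refine ⟨x 0, x 0 * x 1, h0, hb, Subtype.ext ?_⟩
  rw [hg]
  change _ = !![0, x 0, 0; star (x 0), 0, 0; 0, 0, -1] * !![0, 1, 0; star 1, 0, 0; 0, 0, -1] *
    (!![-1, 0, 0; 0, 0, x 0 * x 1; 0, star (x 0 * x 1), 0] * !![-1, 0, 0; 0, 0, 1; 0, star 1, 0])
  ext1 i j
  fin_cases i <;> fin_cases j <;> simp [mul_apply, Fin.sum_univ_three, ← mul_assoc, h0, h2]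

/-- `SU₃(3)` is generated by its involutions. -/
theorem eq_top_of_codeInvol_mem {H : Subgroup SU33} (hH : ∀ c ∈ lines, codeInvol c ∈ H) :
    H = ⊤ := by
  have hsq : ∀ a : SU33, a ^ 2 = 1 → a ∈ H := fun a ha => by
    rcases eq_one_or_eq_codeInvol ha with rfl | ⟨c, hc, rfl⟩
    · exact H.one_mem
    · exact hH c hc
  have hword : ∀ w, wordElt w ∈ H := fun w => by
    induction w with
    | nil => exact H.one_mem
    | cons c w ih => exact H.mul_mem (hsq _ (by rw [pow_two, codeInvol_mul_self])) ih
  -- Descent along stabilisers: `H` contains the elements fixing the first two axes, then those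
  -- fixing the first axis, and finally everything.
  have hdiag : ∀ g : SU33, g * codeInvol 1 * g⁻¹ = codeInvol 1 →
      g * codeInvol 9 * g⁻¹ = codeInvol 9 → g ∈ H := fun g h1 h9 => by
    obtain ⟨a, b, ha, hb, h⟩ := eq_mul_of_eq_diagonal
      (eq_diagonal (mul_inv_eq_iff_eq_mul.1 h1) (mul_inv_eq_iff_eq_mul.1 h9))
    rw [h]
    exact H.mul_mem (H.mul_mem (hsq _ (swapFst_sq _ _)) (hsq _ (swapFst_sq _ _)))
      (H.mul_mem (hsq _ (swapSnd_sq _ _)) (hsq _ (swapSnd_sq _ _)))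
  have hone : (innerCode 1 1 = 1) := by decide
  have hnine : (innerCode 9 9 = 1) := by decide
  have hstab : ∀ g : SU33, g * codeInvol 1 * g⁻¹ = codeInvol 1 → g ∈ H := fun g h1 => by
    obtain ⟨c, hc, h⟩ := exists_conj_codeInvol g hnine
    -- The involutions with codes `1` and `9` commute, hence so do their conjugates under `g`, the
    -- first of which is unchanged.
    have hcom : actCode 1 c = c := by
      apply codeInvol_injOn (mem_lines_actCode hone hc) hc
      have e1 := wordElt_conj (w := [1]) (by simpa [IsWord] using hone) c
      have e2 := wordElt_conj (w := [1]) (by simpa [IsWord] using hone) 9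
      have e3 : wordAct [1] 9 = 9 := by decide
      rw [e3] at e2
      simp only [wordElt, wordAct, force_eq, mul_one] at e1 e2
      rw [← e1, ← h]
      calc _ = g * codeInvol 1 * g⁻¹ * (g * codeInvol 9 * g⁻¹) * (g * codeInvol 1 * g⁻¹)⁻¹ := by
            rw [h1]
        _ = g * (codeInvol 1 * codeInvol 9 * (codeInvol 1)⁻¹) * g⁻¹ := by group
        _ = _ := by rw [e2]
    have hne : c ≠ 1 := by
      rintro rfl
      have : g * codeInvol 9 * g⁻¹ = g * codeInvol 1 * g⁻¹ := h.trans h1.symm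
      rw [mul_left_inj, mul_right_inj] at this
      exact absurd (codeInvol_injOn nine_mem_lines one_mem_lines this) (by decide)
    -- The points fixed by the first involution are its axis and the points orthogonal to it; on the
    -- latter the words are transitive, so `g` can be corrected by an element of `H` to fix the
    -- second axis too.
    have hcov : orbitCovers stabWords
        (fun c => force c fun c => Nat.beq (actCode 1 c) c && !Nat.beq c 1) [9] = true := by
      rw [orbitCovers, lines_eq]
      decide +kernel
    obtain ⟨m, hm, hm1, hm9⟩ := orbitCovers_spec (P := fun c => ∃ m ∈ H,
      m * codeInvol 1 * m⁻¹ = codeInvol 1 ∧ m * codeInvol 9 * m⁻¹ = codeInvol c) hcov (by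
        rintro w hw x ⟨m, hm, hm1, hm9⟩
        refine ⟨wordElt w * m, H.mul_mem (hword w) hm, ?_, ?_⟩
        · calc wordElt w * m * codeInvol 1 * (wordElt w * m)⁻¹
                = wordElt w * (m * codeInvol 1 * m⁻¹) * (wordElt w)⁻¹ := by group
            _ = codeInvol 1 := by rw [hm1, conj_codeInvol_one_of_mem_stabWords hw]
        · rw [← wordElt_conj (isWord_of_mem_stabWords w hw), ← hm9]
          group) (by
        intro x hx
        rw [List.mem_singleton.1 hx]
        exact ⟨1, H.one_mem, by simp, by simp⟩) hc
      (by
        have : Nat.beq c 1 = false := by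
          rw [← Bool.not_eq_true, Nat.beq_eq]
          exact hne
        rw [force_eq, hcom, Nat.beq_refl, this]
        rfl)
    have hmg : m⁻¹ * g ∈ H := by
      apply hdiag
      · calc m⁻¹ * g * codeInvol 1 * (m⁻¹ * g)⁻¹ = m⁻¹ * (g * codeInvol 1 * g⁻¹) * m := by group
          _ = m⁻¹ * (m * codeInvol 1 * m⁻¹) * m := by rw [h1, hm1]
          _ = codeInvol 1 := by group
      · calc m⁻¹ * g * codeInvol 9 * (m⁻¹ * g)⁻¹ = m⁻¹ * (g * codeInvol 9 * g⁻¹) * m := by group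
          _ = m⁻¹ * (m * codeInvol 9 * m⁻¹) * m := by rw [h, hm9]
          _ = codeInvol 9 := by group
    simpa using H.mul_mem hm hmg
  rw [eq_top_iff]
  intro g _
  obtain ⟨c, hc, h⟩ := exists_conj_codeInvol g hone
  obtain ⟨w, hw, rfl⟩ := exists_wordAct_eq hc
  rw [← wordElt_conj hw] at h
  have : (wordElt w)⁻¹ * g ∈ H := by
    apply hstab
    calc (wordElt w)⁻¹ * g * codeInvol 1 * ((wordElt w)⁻¹ * g)⁻¹
        = (wordElt w)⁻¹ * (g * codeInvol 1 * g⁻¹) * wordElt w := by group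
      _ = codeInvol 1 := by rw [h]; group
  simpa using H.mul_mem (hword w) this

/-- A subgroup containing an involution and given words is the whole group if the words are
transitive on the involutions. -/
theorem eq_top_of_orbitCovers {H : Subgroup SU33} {ws : List (List ℕ)} {c : ℕ}
    (hws : ∀ w ∈ ws, IsWord w) (hH : ∀ w ∈ ws, wordElt w ∈ H) (hc : codeInvol c ∈ H)
    (h : orbitCovers ws (fun _ => true) [c] = true) : H = ⊤ := by
  apply eq_top_of_codeInvol_mem
  intro d hd
  refine orbitCovers_spec (P := fun d => codeInvol d ∈ H) h ?_ ?_ hd rfl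
  · intro w hw x hx
    rw [← wordElt_conj (hws w hw)]
    exact H.mul_mem (H.mul_mem (hH w hw) hx) (H.inv_mem (hH w hw))
  · intro x hx
    rwa [List.mem_singleton.1 hx]

/-- A central element is diagonal, and commuting with the swaps of axes makes it a scalar `a`. The
determinant gives `a³ = 1`, while `a³` is the conjugate of `a`. -/
theorem center_eq_bot : Subgroup.center SU33 = ⊥ := by
  rw [eq_bot_iff]
  intro z hz
  rw [Subgroup.mem_center_iff] at hz
  have hd := eq_diagonal (hz _).symm (hz _).symm
  have h1 := congrArg Subtype.val (hz (swapFst 1 star_one_mul_one))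
  have h2 := congrArg Subtype.val (hz (swapSnd 1 star_one_mul_one))
  rw [Submonoid.coe_mul, Submonoid.coe_mul, hd] at h1 h2
  have h01 := congrFun (congrFun h1 0) 1
  have h12 := congrFun (congrFun h2 1) 2
  rw [mul_diagonal, diagonal_mul] at h01 h12
  simp only [swapFst, swapSnd, of_apply, cons_val', cons_val_zero, cons_val_one, cons_val,
    cons_val_fin_one, mul_one, one_mul] at h01 h12
  have hdet := det_coe z
  rw [hd, det_diagonal, Fin.prod_univ_three, h12, h01] at hdet
  have h0 : star (z.1 0 0) = 1 := by
    rw [F9.star_eq, ← hdet]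
    ring
  have h0' : z.1 0 0 = 1 := by rw [← star_star (z.1 0 0), h0, star_one]
  rw [Subgroup.mem_bot]
  apply Subtype.ext
  rw [hd, Submonoid.coe_one, ← diagonal_one, diagonal_eq_diagonal_iff]
  intro i
  fin_cases i
  · exact h0'
  · exact h01.trans h0'
  · exact h12.trans (h01.trans h0')

/-- `U₃(3)` is isomorphic to `SU₃(3)`. -/
noncomputable def mulEquivU33 : U33 ≃* SU33 :=
  (QuotientGroup.quotientMulEquivOfEq center_eq_bot).trans QuotientGroup.quotientBot

/-! ### `SU₃(3)` is not generated by three involutions -/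

/-- The orbit of the first coordinate axis under the three given involutions is closed and does not
contain all normalised vectors. -/
def orbitProper (ws : List (List ℕ)) : Bool :=
  orbit ws (fun t => (lines.any fun d => !t.any (Nat.beq d)) &&
    t.all fun x => ws.all fun w => force (wordAct w x) fun y => t.any (Nat.beq y)) 200 [1] [1]

/-- The computed list is a proper subset of the points preserved by the three involutions, whereas
the whole group is transitive on points. -/
theorem closure_ne_top_of_orbitProper {b c : ℕ} (hb : b ∈ lines) (hc : c ∈ lines)
    (h : orbitProper [[1], [b], [c]] = true) :
    Subgroup.closure {codeInvol 1, codeInvol b, codeInvol c} ≠ ⊤ := by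
  intro htop
  have hws : ∀ w ∈ [[1], [b], [c]], IsWord w := by
    simp [IsWord, (mem_lines_iff.1 one_mem_lines).2.1, (mem_lines_iff.1 hb).2.1,
      (mem_lines_iff.1 hc).2.1]
  obtain ⟨t, h1, hs, h2⟩ := orbit_spec h
  have ht : ∀ x ∈ t, x ∈ lines := h2 (· ∈ lines) (fun w hw x => mem_lines_wordAct (hws w hw))
    (by simpa using one_mem_lines) (by simpa using one_mem_lines)
  rw [Bool.and_eq_true, List.any_eq_true, List.all_eq_true] at h1
  obtain ⟨⟨d, hd, hdt⟩, hcl⟩ := h1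
  simp only [List.all_eq_true, List.any_eq_true, Nat.beq_eq, force_eq, Bool.not_eq_true',
    ← Bool.not_eq_true] at hdt hcl
  have hgen : ∀ w ∈ [[1], [b], [c]], ∀ x ∈ t, ∃ y ∈ t,
      wordElt w * codeInvol x * (wordElt w)⁻¹ = codeInvol y := fun w hw x hx => by
    obtain ⟨y, hy, e⟩ := hcl x hx w hw
    exact ⟨y, hy, by rw [wordElt_conj (hws w hw), e]⟩
  have key : ∀ g ∈ Subgroup.closure {codeInvol 1, codeInvol b, codeInvol c},
      (∀ x ∈ t, ∃ y ∈ t, g * codeInvol x * g⁻¹ = codeInvol y) ∧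
        ∀ x ∈ t, ∃ y ∈ t, g⁻¹ * codeInvol x * g = codeInvol y := by
    intro g hg
    induction hg using Subgroup.closure_induction with
    | mem g hg =>
      obtain ⟨e, he, rfl⟩ : ∃ e, [e] ∈ [[1], [b], [c]] ∧ codeInvol e = g := by
        rcases hg with rfl | rfl | rfl
        · exact ⟨1, by simp, rfl⟩
        · exact ⟨b, by simp, rfl⟩
        · exact ⟨c, by simp, rfl⟩
      have h := hgen [e] he
      simp only [wordElt, mul_one, codeInvol_inv] at h
      simp only [codeInvol_inv]
      exact ⟨h, h⟩
    | one => exact ⟨fun x hx => ⟨x, hx, by simp⟩, fun x hx => ⟨x, hx, by simp⟩⟩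
    | mul g k _ _ ihg ihk =>
      constructor
      · intro x hx
        obtain ⟨y, hy, e⟩ := ihk.1 x hx
        obtain ⟨z, hz, e'⟩ := ihg.1 y hy
        exact ⟨z, hz, by rw [← e', ← e]; group⟩
      · intro x hx
        obtain ⟨y, hy, e⟩ := ihg.2 x hx
        obtain ⟨z, hz, e'⟩ := ihk.2 y hy
        exact ⟨z, hz, by rw [← e', ← e]; group⟩
    | inv g _ ih => exact ⟨by simpa using ih.2, by simpa using ih.1⟩
  obtain ⟨w, hw, rfl⟩ := exists_wordAct_eq hd
  obtain ⟨y, hy, e⟩ := (key (wordElt w) (by rw [htop]; trivial)).1 1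
    (hs (List.mem_singleton_self 1))
  rw [wordElt_conj hw] at e
  exact hdt ⟨y, hy, codeInvol_injOn hd (ht y hy) e⟩

theorem closure_conj_eq_top {G : Type*} [Group G] {a b c : G}
    (h : Subgroup.closure {a, b, c} = ⊤) (g : G) :
    Subgroup.closure {g * a * g⁻¹, g * b * g⁻¹, g * c * g⁻¹} = ⊤ := by
  have := congrArg (Subgroup.map (MulAut.conj g).toMonoidHom) h
  rw [MonoidHom.map_closure, Subgroup.map_top_of_surjective _ (MulAut.conj g).surjective] at this
  simpa [Set.image_insert_eq] using this

/-- Conjugating by words that centralise the first involution reduces the second to one of four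
representatives, with codes `1, 9, 40, 118`. The third then ranges over all 63 involutions; the
identity as third element gives a group generated by the first two. -/
theorem closure_codeInvol_ne_top {b : ℕ} (hb : b ∈ lines) {z : SU33} (hz : z ^ 2 = 1) :
    Subgroup.closure {codeInvol 1, codeInvol b, z} ≠ ⊤ := by
  have hbase : ∀ b ∈ [1, 9, 40, 118], ∀ c ∈ lines, orbitProper [[1], [b], [c]] = true := by
    simp_rw [← List.all_eq_true, orbitProper, lines_eq]
    decide +kernel
  have hreps : ∀ b ∈ [1, 9, 40, 118], b ∈ lines := by
    rw [lines_eq]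
    decide
  have hcov : orbitCovers ([1] :: stabWords) (fun _ => true) [1, 9, 40, 118] = true := by
    rw [orbitCovers, lines_eq]
    decide +kernel
  have hws : ∀ w ∈ [1] :: stabWords, IsWord w := by decide
  have hstab : ∀ w ∈ [1] :: stabWords,
      wordElt w * codeInvol 1 * (wordElt w)⁻¹ = codeInvol 1 := fun w hw => by
    rcases List.mem_cons.1 hw with rfl | hw
    · simp [wordElt]
    · exact conj_codeInvol_one_of_mem_stabWords hw
  refine orbitCovers_spec (P := fun b => ∀ z : SU33, z ^ 2 = 1 →
    Subgroup.closure {codeInvol 1, codeInvol b, z} ≠ ⊤) hcov ?_ ?_ hb rfl z hz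
  · intro w hw x hx z hz htop
    have h := closure_conj_eq_top htop (wordElt w)⁻¹
    have e1 := hstab w hw
    have e2 := wordElt_conj (hws w hw) x
    have e3 : (wordElt w)⁻¹ * codeInvol 1 * ((wordElt w)⁻¹)⁻¹ = codeInvol 1 := by
      nth_rw 1 [← e1]
      group
    have e4 : (wordElt w)⁻¹ * codeInvol (wordAct w x) * ((wordElt w)⁻¹)⁻¹ = codeInvol x := by
      rw [← e2]
      group
    rw [e3, e4] at h
    exact hx _ (by rw [conj_pow, hz, mul_one, mul_inv_cancel]) h
  · intro b hb z hz
    rcases eq_one_or_eq_codeInvol hz with rfl | ⟨c, hc, rfl⟩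
    · intro htop
      refine closure_ne_top_of_orbitProper (hreps b hb) one_mem_lines
        (hbase b hb 1 one_mem_lines) (top_unique (htop.symm.trans_le ?_))
      rw [Subgroup.closure_le]
      rintro x (rfl | rfl | rfl)
      · exact Subgroup.subset_closure (by simp)
      · exact Subgroup.subset_closure (by simp)
      · exact Subgroup.one_mem _
    · exact closure_ne_top_of_orbitProper (hreps b hb) hc (hbase b hb c hc)

/-- `SU₃(3)` is not generated by three elements whose squares are `1`. -/
theorem closure_ne_top_of_sq {x y z : SU33} (hx : x ^ 2 = 1) (hy : y ^ 2 = 1) (hz : z ^ 2 = 1) :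
    Subgroup.closure {x, y, z} ≠ ⊤ := by
  intro htop
  -- An identity generator may be replaced by any involution, since this only enlarges the subgroup.
  obtain ⟨c, hc, hxc⟩ : ∃ c ∈ lines, x ∈ Subgroup.closure {codeInvol c} := by
    rcases eq_one_or_eq_codeInvol hx with rfl | ⟨c, hc, rfl⟩
    · exact ⟨1, one_mem_lines, Subgroup.one_mem _⟩
    · exact ⟨c, hc, Subgroup.mem_closure_singleton_self _⟩
  have htop' : Subgroup.closure {codeInvol c, y, z} = ⊤ := by
    refine top_unique (htop.symm.trans_le ?_)
    rw [Subgroup.closure_le]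
    rintro u (rfl | rfl | rfl)
    · exact Subgroup.closure_mono (by simp) hxc
    · exact Subgroup.subset_closure (by simp)
    · exact Subgroup.subset_closure (by simp)
  obtain ⟨w, hw, rfl⟩ := exists_wordAct_eq hc
  have h := closure_conj_eq_top htop' (wordElt w)⁻¹
  have e : (wordElt w)⁻¹ * codeInvol (wordAct w 1) * ((wordElt w)⁻¹)⁻¹ = codeInvol 1 := by
    rw [← wordElt_conj hw]
    group
  have hsq : ∀ u : SU33, u ^ 2 = 1 → ((wordElt w)⁻¹ * u * ((wordElt w)⁻¹)⁻¹) ^ 2 = 1 :=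
    fun u hu => by rw [conj_pow, hu, mul_one, mul_inv_cancel]
  rw [e] at h
  rcases eq_one_or_eq_codeInvol (hsq y hy) with h1 | ⟨b, hb, h1⟩
  · rw [h1] at h
    refine closure_codeInvol_ne_top one_mem_lines (hsq z hz) (top_unique (h.symm.trans_le ?_))
    rw [Subgroup.closure_le]
    rintro u (rfl | rfl | rfl)
    · exact Subgroup.subset_closure (by simp)
    · exact Subgroup.one_mem _
    · exact Subgroup.subset_closure (by simp)
  · rw [h1] at h
    exact closure_codeInvol_ne_top hb (hsq z hz) h

/-! ### Inverting automorphisms -/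

/-- Conjugacy of the involutions, read as transitivity on non-isotropic points. -/
theorem exists_eq_smul_mulVec {v u : Fin 3 → F9} (hv : star v ⬝ᵥ v = 1) (hu : star u ⬝ᵥ u = 1) :
    ∃ (g : SU33) (t : F9), u = t • g.1 *ᵥ v := by
  obtain ⟨c, hc, l, hl, h1⟩ := exists_mem_lines hv
  obtain ⟨d, hd, m, hm, h2⟩ := exists_mem_lines hu
  obtain ⟨w, hw, rfl⟩ := exists_wordAct_eq hc
  obtain ⟨w', hw', rfl⟩ := exists_wordAct_eq hd
  have e1 := wordElt_conj hw 1
  have e2 := wordElt_conj hw' 1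
  rw [codeInvol.eq_def (wordAct _ _), h1, invol_smul hl] at e1
  rw [codeInvol.eq_def (wordAct _ _), h2, invol_smul hm] at e2
  refine ⟨wordElt w' * (wordElt w)⁻¹, _, eq_smul_of_invol_eq
    ((star_mulVec_dotProduct _ _ _).trans hv) hu ?_⟩
  rw [← conj_invol, ← e1, ← e2]
  group

/-! ### Cyclic vectors and Krylov matrices -/

/-- The sum of the principal minors of order two. -/
def minorSum {R : Type*} [CommRing R] (X : Matrix (Fin 3) (Fin 3) R) : R := X.adjugate.trace

theorem adjugate_eq {R : Type*} [CommRing R] (X : Matrix (Fin 3) (Fin 3) R) :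
    adjugate X = X * X - X.trace • X + minorSum X • (1 : Matrix (Fin 3) (Fin 3) R) := by
  ext1 i j
  fin_cases i <;> fin_cases j <;>
  simp [adjugate_fin_three, minorSum, trace_fin_three, mul_apply, Fin.sum_univ_three, one_apply]
    <;> ring

theorem cube_eq {X : Matrix (Fin 3) (Fin 3) F9} (h : X.det = 1) :
    X * (X * X) = X.trace • (X * X) - minorSum X • X + 1 := by
  have h1 := mul_adjugate X
  rw [adjugate_eq, h, one_smul, mul_add, mul_sub, mul_smul_comm, mul_smul_comm, mul_one] at h1
  rw [← h1]
  abel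

/-- The matrix with columns `v`, `X v`, `X² v`. -/
def krylov (X : Matrix (Fin 3) (Fin 3) F9) (v : Fin 3 → F9) : Matrix (Fin 3) (Fin 3) F9 :=
  (of ![v, X *ᵥ v, X *ᵥ X *ᵥ v])ᵀ

theorem mulVec_mulVec_mulVec {X : Matrix (Fin 3) (Fin 3) F9} (h : X.det = 1) (w : Fin 3 → F9) :
    X *ᵥ X *ᵥ X *ᵥ w = X.trace • X *ᵥ X *ᵥ w - minorSum X • X *ᵥ w + w := by
  have hl : X *ᵥ X *ᵥ X *ᵥ w = (X * (X * X)) *ᵥ w := by simp only [mulVec_mulVec]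
  rw [hl, cube_eq h, add_mulVec, sub_mulVec,
    one_mulVec, smul_mulVec, smul_mulVec, mulVec_mulVec]

/-- Otherwise a non-zero `p` annihilates `v`, `x v`, `x² v`. The vectors `w` such that `p` kills
`w`, `x w`, `x² w` form a subspace invariant under `x`; it contains `v`, so it is invariant under
`invol v` and hence under the whole group. By transitivity it contains every coordinate vector,
which makes `p` zero. -/
theorem det_krylov_ne_zero {x : SU33} {v : Fin 3 → F9} (hv : star v ⬝ᵥ v = 1)
    (h : Subgroup.closure {invol v, x} = ⊤) : (krylov x.1 v).det ≠ 0 := by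
  intro hdet
  obtain ⟨p, hp0, hp⟩ := exists_vecMul_eq_zero_iff.2 hdet
  have hx := det_coe x
  set U : Set (Fin 3 → F9) := {w | p ⬝ᵥ w = 0 ∧ p ⬝ᵥ x.1 *ᵥ w = 0 ∧ p ⬝ᵥ x.1 *ᵥ x.1 *ᵥ w = 0}
    with hU
  have hvU : v ∈ U := ⟨congrFun hp 0, congrFun hp 1, congrFun hp 2⟩
  have hUsmul : ∀ (t : F9), ∀ w ∈ U, t • w ∈ U := by
    rintro t w ⟨h1, h2, h3⟩
    simp only [hU, Set.mem_ofPred_eq, mulVec_smul, dotProduct_smul, h1, h2, h3, smul_zero, and_self]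
  have hUadd : ∀ w ∈ U, ∀ w' ∈ U, w + w' ∈ U := by
    rintro w ⟨h1, h2, h3⟩ w' ⟨h1', h2', h3'⟩
    simp only [hU, Set.mem_ofPred_eq, mulVec_add, dotProduct_add, h1, h2, h3, h1', h2', h3',
      add_zero, and_self]
  have hUx : ∀ w ∈ U, x.1 *ᵥ w ∈ U := by
    rintro w ⟨h1, h2, h3⟩
    refine ⟨h2, h3, ?_⟩
    rw [mulVec_mulVec_mulVec hx, dotProduct_add, dotProduct_sub, dotProduct_smul, dotProduct_smul,
      h1, h2, h3, smul_zero, smul_zero, sub_zero, add_zero]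
  have hcancel : ∀ w, x.1 *ᵥ (x⁻¹).1 *ᵥ w = w := fun w => by
    rw [mulVec_mulVec, coe_inv, coe_mul_coe_star, one_mulVec]
  have hUx' : ∀ w ∈ U, (x⁻¹).1 *ᵥ w ∈ U := by
    rintro w ⟨h1, h2, h3⟩
    refine ⟨?_, ?_, ?_⟩
    · have h4 := mulVec_mulVec_mulVec hx ((x⁻¹).1 *ᵥ w)
      rw [hcancel] at h4
      -- Cayley–Hamilton with determinant `1` expresses the inverse as a polynomial in `x`.
      have h5 : (x⁻¹).1 *ᵥ w = x.1 *ᵥ x.1 *ᵥ w - x.1.trace • x.1 *ᵥ w + minorSum x.1 • w := by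
        rw [h4]
        abel
      rw [h5, dotProduct_add, dotProduct_sub, dotProduct_smul, dotProduct_smul, h1, h2, h3,
        smul_zero, smul_zero, sub_zero, add_zero]
    · rwa [hcancel]
    · rwa [hcancel]
  have hUv : ∀ w ∈ U, (invol v).1 *ᵥ w ∈ U := fun w hw => by
    rw [coe_invol hv, reflMatrix_mulVec, ← neg_one_smul F9]
    exact hUsmul _ _ (hUadd _ hw _ (hUsmul _ _ hvU))
  have key : ∀ g ∈ Subgroup.closure {invol v, x},
      (∀ w ∈ U, g.1 *ᵥ w ∈ U) ∧ ∀ w ∈ U, (g⁻¹).1 *ᵥ w ∈ U := by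
    intro g hg
    induction hg using Subgroup.closure_induction with
    | mem g hg =>
      rcases hg with rfl | rfl
      · rw [invol_inv]
        exact ⟨hUv, hUv⟩
      · exact ⟨hUx, hUx'⟩
    | one => simp
    | mul g k _ _ ihg ihk =>
      constructor
      · intro w hw
        rw [Submonoid.coe_mul, ← mulVec_mulVec]
        exact ihg.1 _ (ihk.1 _ hw)
      · intro w hw
        rw [_root_.mul_inv_rev, Submonoid.coe_mul, ← mulVec_mulVec]
        exact ihk.2 _ (ihg.2 _ hw)
    | inv g _ ih => exact ⟨ih.2, by simpa using ih.1⟩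
  apply hp0
  ext1 i
  obtain ⟨g, t, hu⟩ := exists_eq_smul_mulVec hv
    (show star (Pi.single i 1 : Fin 3 → F9) ⬝ᵥ Pi.single i 1 = 1 by simp)
  have h1 := (hUsmul t _ ((key g (by rw [h]; trivial)).1 v hvU)).1
  rw [← hu, dotProduct_single_one] at h1
  exact h1

/-- The matrix of `X` in the basis `v`, `X v`, `X² v`. -/
def companion (X : Matrix (Fin 3) (Fin 3) F9) : Matrix (Fin 3) (Fin 3) F9 :=
  !![0, 0, 1; 1, 0, -minorSum X; 0, 1, X.trace]

theorem mul_krylov {X : Matrix (Fin 3) (Fin 3) F9} (h : X.det = 1) (v : Fin 3 → F9) :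
    X * krylov X v = krylov X v * companion X := by
  have h3 := mulVec_mulVec_mulVec h v
  ext1 i j
  rw [mul_apply (M := krylov X v), Fin.sum_univ_three]
  fin_cases j
  · change (X *ᵥ v) i = v i * 0 + (X *ᵥ v) i * 1 + (X *ᵥ X *ᵥ v) i * 0
    ring
  · change (X *ᵥ X *ᵥ v) i = v i * 0 + (X *ᵥ v) i * 0 + (X *ᵥ X *ᵥ v) i * 1
    ring
  · change (X *ᵥ X *ᵥ X *ᵥ v) i =
      v i * 1 + (X *ᵥ v) i * -minorSum X + (X *ᵥ X *ᵥ v) i * X.trace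
    rw [h3]
    simp only [Pi.add_apply, Pi.sub_apply, Pi.smul_apply, smul_eq_mul]
    ring

theorem companion_transpose (X : Matrix (Fin 3) (Fin 3) F9) : companion Xᵀ = companion X := by
  rw [companion, companion, trace_transpose, minorSum, minorSum, ← adjugate_transpose,
    trace_transpose]

/-- The product is a Hankel matrix: its entry `(Xⁱ v) · ((Xᵀ)ʲ u)` depends only on `i + j`. -/
theorem transpose_krylov_mul (X : Matrix (Fin 3) (Fin 3) F9) (v u : Fin 3 → F9) :
    ((krylov X v)ᵀ * krylov Xᵀ u)ᵀ = (krylov X v)ᵀ * krylov Xᵀ u := by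
  have hd : ∀ a b : Fin 3 → F9, a ⬝ᵥ Xᵀ *ᵥ b = X *ᵥ a ⬝ᵥ b := fun a b => by
    rw [dotProduct_mulVec, vecMul_transpose]
  have k0 : (krylov X v)ᵀ 0 = v := rfl
  have k1 : (krylov X v)ᵀ 1 = X *ᵥ v := rfl
  have k2 : (krylov X v)ᵀ 2 = X *ᵥ X *ᵥ v := rfl
  have l0 : (krylov Xᵀ u)ᵀ 0 = u := rfl
  have l1 : (krylov Xᵀ u)ᵀ 1 = Xᵀ *ᵥ u := rfl
  have l2 : (krylov Xᵀ u)ᵀ 2 = Xᵀ *ᵥ Xᵀ *ᵥ u := rfl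
  ext1 i j
  change (krylov X v)ᵀ j ⬝ᵥ (krylov Xᵀ u)ᵀ i = (krylov X v)ᵀ i ⬝ᵥ (krylov Xᵀ u)ᵀ j
  fin_cases i <;> fin_cases j <;>
  simp only [Fin.zero_eta, Fin.mk_one, Fin.reduceFinMk, k0, k1, k2, l0, l1, l2, hd]

/-- For unitary `x` the transpose is the entrywise conjugate of `x⁻¹`. This transfers cyclicity of
`v` for `x⁻¹` to cyclicity of `v̄` for `xᵀ`. -/
theorem krylov_transpose_star (x : SU33) (v : Fin 3 → F9) :
    krylov x.1ᵀ (star v) = (starRingEnd F9).mapMatrix (krylov (x⁻¹).1 v) := by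
  have hs : ∀ w : Fin 3 → F9, star ((x⁻¹).1 *ᵥ w) = x.1ᵀ *ᵥ star w := fun w => by
    rw [star_mulVec, coe_inv, star_eq_conjTranspose, conjTranspose_conjTranspose,
      ← mulVec_transpose]
  ext1 i j
  fin_cases j
  · rfl
  · exact congrFun (hs v).symm i
  · refine congrFun (?_ : x.1ᵀ *ᵥ x.1ᵀ *ᵥ star v = star ((x⁻¹).1 *ᵥ (x⁻¹).1 *ᵥ v)) i
    rw [hs, hs]

/-- An involution and an element which generate `SU₃(3)` are simultaneously conjugate to their
transposes. -/
theorem exists_conj_transpose {x : SU33} {v : Fin 3 → F9} (hv : star v ⬝ᵥ v = 1)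
    (h : Subgroup.closure {invol v, x} = ⊤) :
    ∃ P : Matrix (Fin 3) (Fin 3) F9, IsUnit P.det ∧ P * x.1 = x.1ᵀ * P ∧
      P * (invol v).1 = (invol v).1ᵀ * P := by
  set X := x.1 with hX
  have hdX : X.det = 1 := det_coe x
  obtain ⟨K, hK⟩ : ∃ K, K = krylov X v := ⟨_, rfl⟩
  obtain ⟨L, hL⟩ : ∃ L, L = krylov Xᵀ (star v) := ⟨_, rfl⟩
  have hKdet : IsUnit K.det := hK ▸ (det_krylov_ne_zero hv h).isUnit
  have hLdet : IsUnit L.det := by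
    have h' : Subgroup.closure {invol v, x⁻¹} = ⊤ := by
      refine top_unique (h.symm.trans_le ?_)
      rw [Subgroup.closure_le]
      rintro y (rfl | rfl)
      · exact Subgroup.subset_closure (by simp)
      · rw [SetLike.mem_coe, ← Subgroup.inv_mem_iff]
        exact Subgroup.subset_closure (by simp)
    have hLK : L = (starRingEnd F9).mapMatrix (krylov (x⁻¹).1 v) :=
      hL.trans (krylov_transpose_star x v)
    rw [hLK, ← RingHom.map_det]
    exact ((det_krylov_ne_zero hv h').isUnit).map _
  -- `P` carries the basis `Xⁱ v` to the basis `(Xᵀ)ⁱ v̄`. In these bases `X` and `Xᵀ` have the same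
  -- companion matrix, so `P` intertwines them.
  obtain ⟨P, hP⟩ : ∃ P, P = L * K⁻¹ := ⟨_, rfl⟩
  have hPK : P * K = L := by rw [hP, nonsing_inv_mul_cancel_right _ _ hKdet]
  have hPdet : IsUnit P.det := by
    rw [← hPK, det_mul] at hLdet
    exact isUnit_of_mul_isUnit_left hLdet
  have hPX : P * X = Xᵀ * P := by
    have : P * X * K = Xᵀ * P * K := by
      rw [mul_assoc, hK, mul_krylov hdX, ← hK, ← mul_assoc, hPK, mul_assoc, hPK, hL,
        mul_krylov (by rw [det_transpose, hdX]), companion_transpose]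
    exact ((Matrix.isUnit_iff_isUnit_det _).2 hKdet).mul_right_cancel this
  -- The congruent matrix `Kᵀ P K = Kᵀ L` is symmetric.
  have hsym : Pᵀ = P := by
    have h1 : (Kᵀ * L)ᵀ = Kᵀ * L := by rw [hK, hL, transpose_krylov_mul]
    rw [← hPK, transpose_mul, transpose_mul, transpose_transpose, mul_assoc] at h1
    have h2 : Kᵀ * (Pᵀ * K) = Kᵀ * (P * K) := h1
    have hKt : IsUnit Kᵀ.det := by rwa [det_transpose]
    have h3 : Pᵀ * K = P * K := ((Matrix.isUnit_iff_isUnit_det _).2 hKt).mul_left_cancel h2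
    exact ((Matrix.isUnit_iff_isUnit_det _).2 hKdet).mul_right_cancel h3
  have hPv : P *ᵥ v = star v := by
    have : (P * K).col 0 = L.col 0 := by rw [hPK]
    rw [hK, hL] at this
    exact this
  -- From `P v = v̄` and the symmetry of `P`, both `P (v v*)` and `(v v*)ᵀ P` equal `v̄ v*`.
  have hPc : P * (invol v).1 = (invol v).1ᵀ * P := by
    have hPv' : v ᵥ* P = star v := by rw [← hPv, ← vecMul_transpose, hsym]
    rw [coe_invol hv, reflMatrix, transpose_sub, transpose_neg, transpose_one,
      transpose_vecMulVec, mul_sub, sub_mul, mul_vecMulVec, vecMulVec_mul, hPv, hPv']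
    simp
  exact ⟨P, hPdet, hPX, hPc⟩

/-- An involution and an element which generate `SU₃(3)` are fixed and inverted, respectively, by
some automorphism. -/
theorem exists_mulEquiv_inv {c x : SU33} (hc : c ^ 2 = 1) (h : Subgroup.closure {c, x} = ⊤) :
    ∃ e : SU33 ≃* SU33, e c = c ∧ e x = x⁻¹ := by
  rcases eq_one_or_eq_invol hc with rfl | ⟨v, hv, rfl⟩
  · have hcen : (⊤ : Subgroup SU33) ≤ Subgroup.center SU33 := by
      rw [← h, Subgroup.closure_le]
      rintro y (rfl | rfl)
      · exact Subgroup.one_mem _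
      · rw [SetLike.mem_coe, Subgroup.mem_center_iff]
        intro g
        have hg : g ∈ Subgroup.closure {1, y} := by rw [h]; trivial
        have : Subgroup.closure {1, y} ≤ Subgroup.centralizer {y} := by
          rw [Subgroup.closure_le]
          rintro z (rfl | rfl)
          · exact Subgroup.one_mem _
          · simp [Subgroup.mem_centralizer_iff]
        exact (Subgroup.mem_centralizer_iff.1 (this hg) y rfl).symm
    rw [center_eq_bot] at hcen
    exact absurd (Subgroup.mem_bot.1 (hcen (Subgroup.mem_top (codeInvol 1))))
      (codeInvol_ne_one (mem_lines_iff.1 one_mem_lines).2.1)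
  · obtain ⟨P, hPdet, hPX, hPc⟩ := exists_conj_transpose hv h
    let conj : Matrix (Fin 3) (Fin 3) F9 →* Matrix (Fin 3) (Fin 3) F9 :=
      { toFun := fun A => P⁻¹ * A * P
        map_one' := by rw [mul_one, nonsing_inv_mul _ hPdet]
        map_mul' := fun A B => by
          rw [mul_assoc (P⁻¹ * A), mul_assoc P⁻¹ B, ← mul_assoc P, mul_nonsing_inv _ hPdet, one_mul]
          simp only [mul_assoc] }
    let f : SU33 →* Matrix (Fin 3) (Fin 3) F9 :=
      (conj.comp (starRingEnd F9).mapMatrix.toMonoidHom).comp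
        (specialUnitaryGroup (Fin 3) F9).subtype
    have hf : ∀ g : SU33, f g = P⁻¹ * (g⁻¹).1ᵀ * P := fun g => by
      rw [coe_inv, star_eq_conjTranspose, conjTranspose_transpose]
      rfl
    have hfc : f (invol v) = (invol v).1 := by
      rw [hf, invol_inv, mul_assoc, ← hPc, nonsing_inv_mul_cancel_left _ _ hPdet]
    have hfx : f x = (x⁻¹).1 := by
      have h1 : P = (x⁻¹).1ᵀ * P * x.1 := by
        rw [mul_assoc, hPX, ← mul_assoc, ← transpose_mul, coe_inv, coe_mul_coe_star,
          transpose_one, one_mul]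
      calc f x = P⁻¹ * ((x⁻¹).1ᵀ * P) * (x.1 * (x⁻¹).1) := by
            rw [hf, coe_inv, coe_mul_coe_star, mul_one, mul_assoc]
        _ = P⁻¹ * ((x⁻¹).1ᵀ * P * x.1) * (x⁻¹).1 := by simp only [mul_assoc]
        _ = (x⁻¹).1 := by rw [← h1, nonsing_inv_mul _ hPdet, one_mul]
    -- `P` is not known to be unitary; the values of `f` lie in the group because those on the two
    -- generators do.
    have hmem : ∀ g, f g ∈ specialUnitaryGroup (Fin 3) F9 := fun g => by
      have hg : g ∈ Subgroup.closure {invol v, x} := by rw [h]; trivial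
      induction hg using Subgroup.closure_induction with
      | mem g hg =>
        rcases hg with rfl | rfl
        · rw [hfc]
          exact (invol v).2
        · rw [hfx]
          exact (g⁻¹).2
      | one =>
        rw [map_one]
        exact one_mem _
      | mul g k _ _ ihg ihk =>
        rw [map_mul]
        exact mul_mem ihg ihk
      | inv g _ ih =>
        have h1 : f g⁻¹ * f g = 1 := by rw [← map_mul, inv_mul_cancel, map_one]
        have h2 : f g * ((⟨f g, ih⟩ : SU33)⁻¹).1 = 1 := coe_mul_coe_star ⟨f g, ih⟩
        rw [left_inv_eq_right_inv h1 h2]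
        exact (_ : SU33).2
    let F : SU33 →* SU33 := f.codRestrict _ hmem
    have hFc : F (invol v) = invol v := Subtype.ext hfc
    have hFx : F x = x⁻¹ := Subtype.ext hfx
    have hFF : F.comp F = MonoidHom.id _ := by
      refine MonoidHom.eq_of_eqOn_dense h ?_
      rintro y (rfl | rfl)
      · change F (F (invol v)) = invol v
        rw [hFc, hFc]
      · change F (F y) = y
        rw [hFx, map_inv, hFx, inv_inv]
    exact ⟨F.toMulEquiv F hFF hFF, hFc, hFx⟩

end SU33

/-! ### Maps whose automorphism group has at most two orbits -/

namespace FlagMap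

variable {M : FlagMap}

/-- The involutions `p`, `q`, `t` may take the roles of `r₀`, `r₁`, `r₂`. -/
structure IsGenTriple (M : FlagMap) (p q t : Equiv.Perm M.Flag) : Prop where
  p_sq : p ^ 2 = 1
  q_sq : q ^ 2 = 1
  t_sq : t ^ 2 = 1
  comm : Commute p t
  closure_eq : Subgroup.closure {p, q, t} = M.monodromy

theorem commute_r₀_r₂ (M : FlagMap) : Commute M.r₀ M.r₂ := by
  have h := M.r₀r₂_sq
  rw [pow_two] at h
  have h0 : M.r₀⁻¹ = M.r₀ := inv_eq_of_mul_eq_one_left (by rw [← pow_two, M.r₀_sq])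
  have h2 : M.r₂⁻¹ = M.r₂ := inv_eq_of_mul_eq_one_left (by rw [← pow_two, M.r₂_sq])
  have := eq_inv_of_mul_eq_one_left h
  rwa [mul_inv_rev, h0, h2] at this

theorem isGenTriple (M : FlagMap) : M.IsGenTriple M.r₀ M.r₁ M.r₂ :=
  ⟨M.r₀_sq, M.r₁_sq, M.r₂_sq, M.commute_r₀_r₂, rfl⟩

/-- This triple and the Petrie triple reduce the classes with a superscript to those without. -/
theorem isGenTriple_dual (M : FlagMap) : M.IsGenTriple M.r₂ M.r₁ M.r₀ := by
  refine ⟨M.r₂_sq, M.r₁_sq, M.r₀_sq, M.commute_r₀_r₂.symm, ?_⟩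
  rw [monodromy]
  congr 1
  ext x
  simp only [Set.mem_insert_iff, Set.mem_singleton_iff]
  tauto

theorem isGenTriple_petrie (M : FlagMap) : M.IsGenTriple M.r₀ M.r₁ (M.r₀ * M.r₂) := by
  refine ⟨M.r₀_sq, M.r₁_sq, M.r₀r₂_sq, (Commute.refl _).mul_right M.commute_r₀_r₂, ?_⟩
  apply le_antisymm
  · rw [Subgroup.closure_le]
    rintro x (rfl | rfl | rfl)
    · exact M.r₀_mem
    · exact M.r₁_mem
    · exact M.monodromy.mul_mem M.r₀_mem M.r₂_mem
  · rw [monodromy, Subgroup.closure_le]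
    have h0 : M.r₀ ∈ Subgroup.closure {M.r₀, M.r₁, M.r₀ * M.r₂} :=
      Subgroup.subset_closure (by simp)
    rintro x (rfl | rfl | rfl)
    · exact h0
    · exact Subgroup.subset_closure (by simp)
    · rw [SetLike.mem_coe, ← Subgroup.mul_mem_cancel_left _ h0]
      exact Subgroup.subset_closure (by simp)

theorem smul_apply_of_mem (a : M.Aut) {r : Equiv.Perm M.Flag} (hr : r ∈ M.monodromy)
    (x : M.Flag) : r (a • x) = a • r x :=
  DFunLike.congr_fun (Subgroup.mem_centralizer_iff.1 a.2 r hr) x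

/-- The action is semiregular because the monodromy group, which it centralises, is transitive. -/
theorem eq_of_smul_eq {a b : M.Aut} {x : M.Flag} (h : a • x = b • x) : a = b := by
  apply Subtype.ext
  ext y
  obtain ⟨g, hg, rfl⟩ := M.connected x y
  exact (smul_apply_of_mem a hg x).symm.trans ((congrArg g h).trans (smul_apply_of_mem b hg x))

/-- The projection to `M / Aut M` followed by the isomorphism: an equivariant labelling of flags
whose fibres are the orbits of `Aut M`. -/
theorem exists_isotopy {N : FlagMap} (h : M.quotientMap.Isomorphic N) :
    ∃ k : M.Flag → N.Flag, (∀ x, k (M.r₀ x) = N.r₀ (k x)) ∧ (∀ x, k (M.r₁ x) = N.r₁ (k x)) ∧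
      (∀ x, k (M.r₂ x) = N.r₂ (k x)) ∧ ∀ x y, k x = k y ↔ ∃ a : M.Aut, a • x = y := by
  obtain ⟨f, h0, h1, h2⟩ := h
  refine ⟨fun x => f (Quotient.mk _ x), fun x => h0 (Quotient.mk _ x),
    fun x => h1 (Quotient.mk _ x), fun x => h2 (Quotient.mk _ x),
    fun x y => ?_⟩
  refine (f.injective.eq_iff.trans Quotient.eq).trans ?_
  rw [MulAction.orbitRel_apply]
  constructor
  · rintro ⟨a, ha⟩
    exact ⟨a⁻¹, inv_smul_eq_iff.2 ha.symm⟩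
  · rintro ⟨a, ha⟩
    exact ⟨a⁻¹, inv_smul_eq_iff.2 ha.symm⟩

namespace IsGenTriple

variable {p q t : Equiv.Perm M.Flag}

theorem p_mem (h : M.IsGenTriple p q t) : p ∈ M.monodromy :=
  h.closure_eq ▸ Subgroup.subset_closure (by simp)

theorem q_mem (h : M.IsGenTriple p q t) : q ∈ M.monodromy :=
  h.closure_eq ▸ Subgroup.subset_closure (by simp)

theorem t_mem (h : M.IsGenTriple p q t) : t ∈ M.monodromy :=
  h.closure_eq ▸ Subgroup.subset_closure (by simp)

theorem pp (h : M.IsGenTriple p q t) (x : M.Flag) : p (p x) = x := apply_apply_of_sq h.p_sq x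
theorem qq (h : M.IsGenTriple p q t) (x : M.Flag) : q (q x) = x := apply_apply_of_sq h.q_sq x
theorem tt (h : M.IsGenTriple p q t) (x : M.Flag) : t (t x) = x := apply_apply_of_sq h.t_sq x
theorem pt (h : M.IsGenTriple p q t) (x : M.Flag) : p (t x) = t (p x) :=
  DFunLike.congr_fun h.comm x

/-- A set of flags which is invariant under `p`, `q`, `t` contains all flags. -/
theorem induction (h : M.IsGenTriple p q t) {P : M.Flag → Prop} {x : M.Flag} (hx : P x)
    (hp : ∀ x, P x → P (p x)) (hq : ∀ x, P x → P (q x)) (ht : ∀ x, P x → P (t x)) (y : M.Flag) :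
    P y := by
  obtain ⟨g, hg, rfl⟩ := M.connected x y
  change g ∈ M.monodromy at hg
  rw [← h.closure_eq] at hg
  have key : (∀ z, P z → P (g z)) ∧ ∀ z, P z → P (g⁻¹ z) := by
    induction hg using Subgroup.closure_induction with
    | mem g hg =>
      have hinv : ∀ r : Equiv.Perm M.Flag, r ^ 2 = 1 → r⁻¹ = r := fun r hr =>
        inv_eq_of_mul_eq_one_left (by rw [← pow_two, hr])
      rcases hg with rfl | rfl | rfl
      · rw [hinv _ h.p_sq]
        exact ⟨hp, hp⟩
      · rw [hinv _ h.q_sq]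
        exact ⟨hq, hq⟩
      · rw [hinv _ h.t_sq]
        exact ⟨ht, ht⟩
    | one => exact ⟨fun z hz => hz, fun z hz => hz⟩
    | mul g k _ _ ihg ihk =>
      refine ⟨fun z hz => ihg.1 _ (ihk.1 z hz), fun z hz => ?_⟩
      rw [mul_inv_rev]
      exact ihk.2 _ (ihg.2 z hz)
    | inv g _ ih => exact ⟨ih.2, by simpa using ih.1⟩
  exact key.1 x hx

theorem mem_aut (h : M.IsGenTriple p q t) {f : Equiv.Perm M.Flag} (hp : ∀ x, f (p x) = p (f x))
    (hq : ∀ x, f (q x) = q (f x)) (ht : ∀ x, f (t x) = t (f x)) : f ∈ M.Aut := by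
  have : M.monodromy ≤ Subgroup.centralizer {f} := by
    rw [← h.closure_eq, Subgroup.closure_le]
    rintro r (rfl | rfl | rfl) <;> rw [SetLike.mem_coe, Subgroup.mem_centralizer_singleton_iff]
    · exact Equiv.ext fun x => (hp x).symm
    · exact Equiv.ext fun x => (hq x).symm
    · exact Equiv.ext fun x => (ht x).symm
  rw [Aut, Subgroup.mem_centralizer_iff]
  intro r hr
  exact Subgroup.mem_centralizer_singleton_iff.1 (this hr)

/-- If the automorphism group is transitive on flags, it is generated by three elements with
square `1`. -/
theorem exists_closure_eq_top_of_transitive (h : M.IsGenTriple p q t)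
    (htr : ∀ x y : M.Flag, ∃ a : M.Aut, a • x = y) :
    ∃ a b c : M.Aut, a ^ 2 = 1 ∧ b ^ 2 = 1 ∧ c ^ 2 = 1 ∧ Subgroup.closure {a, b, c} = ⊤ := by
  obtain ⟨x⟩ := M.nonempty
  obtain ⟨a, ha⟩ := htr x (p x)
  obtain ⟨b, hb⟩ := htr x (q x)
  obtain ⟨c, hc⟩ := htr x (t x)
  have hsq : ∀ {a : M.Aut} {r : Equiv.Perm M.Flag}, r ∈ M.monodromy → r (r x) = x →
      a • x = r x → a ^ 2 = 1 := fun {a r} hr h ha => by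
    apply eq_of_smul_eq (x := x)
    rw [pow_two, mul_smul, ha, ← smul_apply_of_mem a hr, ha, h, one_smul]
  refine ⟨a, b, c, hsq h.p_mem (h.pp x) ha, hsq h.q_mem (h.qq x) hb, hsq h.t_mem (h.tt x) hc, ?_⟩
  rw [eq_top_iff]
  intro d _
  -- The orbit of `x` under the subgroup is all of the flags; by semiregularity the subgroup is
  -- everything.
  have key : ∀ y, ∃ e ∈ Subgroup.closure {a, b, c}, e • x = y := by
    have hstep : ∀ {a' : M.Aut} {r : Equiv.Perm M.Flag}, r ∈ M.monodromy → a' • x = r x →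
        a' ∈ ({a, b, c} : Set M.Aut) → ∀ y, (∃ e ∈ Subgroup.closure {a, b, c}, e • x = y) →
        ∃ e ∈ Subgroup.closure {a, b, c}, e • x = r y := by
      rintro a' r hr ha' hmem y ⟨e, he, rfl⟩
      refine ⟨e * a', Subgroup.mul_mem _ he (Subgroup.subset_closure hmem), ?_⟩
      rw [mul_smul, ha', smul_apply_of_mem e hr]
    exact h.induction (x := x) ⟨1, Subgroup.one_mem _, one_smul _ x⟩ (hstep h.p_mem ha (by simp))
      (hstep h.q_mem hb (by simp)) (hstep h.t_mem hc (by simp))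
  obtain ⟨e, he, hed⟩ := key (d • x)
  rwa [← eq_of_smul_eq hed]

/-- If the automorphism group has two orbits on flags, which are transposed by `p` and preserved by
`q` and `t`, it is generated by three elements with square `1`. -/
theorem exists_closure_eq_top_of_two (h : M.IsGenTriple p q t) (k : M.Flag → Bool)
    (hk : ∀ x y, k x = k y ↔ ∃ a : M.Aut, a • x = y) (hp : ∀ x, k (p x) = !k x)
    (hq : ∀ x, k (q x) = k x) (ht : ∀ x, k (t x) = k x) :
    ∃ a b c : M.Aut, a ^ 2 = 1 ∧ b ^ 2 = 1 ∧ c ^ 2 = 1 ∧ Subgroup.closure {a, b, c} = ⊤ := by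
  obtain ⟨x⟩ := M.nonempty
  obtain ⟨a, ha⟩ := (hk x (q x)).1 (hq x).symm
  obtain ⟨b, hb⟩ := (hk (p x) (q (p x))).1 (hq (p x)).symm
  obtain ⟨c, hc⟩ := (hk x (t x)).1 (ht x).symm
  have hsq : ∀ {a : M.Aut} {r : Equiv.Perm M.Flag} {x : M.Flag}, r ∈ M.monodromy →
      r (r x) = x → a • x = r x → a ^ 2 = 1 := fun {a r x} hr h ha => by
    apply eq_of_smul_eq (x := x)
    rw [pow_two, mul_smul, ha, ← smul_apply_of_mem a hr, ha, h, one_smul]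
  refine ⟨a, b, c, hsq h.q_mem (h.qq _) ha, hsq h.q_mem (h.qq _) hb, hsq h.t_mem (h.tt _) hc, ?_⟩
  have ha' : a ∈ Subgroup.closure {a, b, c} := Subgroup.subset_closure (by simp)
  have hb' : b ∈ Subgroup.closure {a, b, c} := Subgroup.subset_closure (by simp)
  have hc' : c ∈ Subgroup.closure {a, b, c} := Subgroup.subset_closure (by simp)
  rw [eq_top_iff]
  intro d _
  have key : ∀ y, ∃ e ∈ Subgroup.closure {a, b, c}, e • x = y ∨ e • p x = y := by
    refine h.induction (x := x) ⟨1, Subgroup.one_mem _, Or.inl (one_smul _ x)⟩ ?_ ?_ ?_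
    · rintro y ⟨e, he, rfl | rfl⟩
      · exact ⟨e, he, Or.inr (smul_apply_of_mem e h.p_mem _).symm⟩
      · exact ⟨e, he, Or.inl (by rw [smul_apply_of_mem e h.p_mem, h.pp])⟩
    · rintro y ⟨e, he, rfl | rfl⟩
      · exact ⟨e * a, Subgroup.mul_mem _ he ha',
          Or.inl (by rw [mul_smul, ha, smul_apply_of_mem e h.q_mem])⟩
      · exact ⟨e * b, Subgroup.mul_mem _ he hb',
          Or.inr (by rw [mul_smul, hb, smul_apply_of_mem e h.q_mem])⟩
    -- As `p` commutes with `t`, the element `c` also takes `p x` to `t (p x)`, so no fourth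
    -- generator is needed.
    · rintro y ⟨e, he, rfl | rfl⟩
      · exact ⟨e * c, Subgroup.mul_mem _ he hc',
          Or.inl (by rw [mul_smul, hc, smul_apply_of_mem e h.t_mem])⟩
      · exact ⟨e * c, Subgroup.mul_mem _ he hc', Or.inr (by
          rw [mul_smul, ← smul_apply_of_mem c h.p_mem, hc, h.pt, smul_apply_of_mem e h.t_mem])⟩
  obtain ⟨e, he, hed | hed⟩ := key (d • x)
  · rwa [← eq_of_smul_eq hed]
  · exfalso
    have h1 : k (p x) = k x := (hk _ _).2 ⟨d⁻¹ * e, by rw [mul_smul, hed, inv_smul_smul]⟩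
    rw [hp] at h1
    exact Bool.not_ne_self _ h1

/-- If the automorphism group has two orbits on flags, which are transposed by `p` and `q` and
preserved by `t`, it is generated by an element `c` with `c² = 1` and an element `d`, and it has no
automorphism which fixes `c` and inverts `d`. -/
theorem exists_closure_eq_top_of_twoEx (h : M.IsGenTriple p q t) (k : M.Flag → Bool)
    (hk : ∀ x y, k x = k y ↔ ∃ a : M.Aut, a • x = y) (hp : ∀ x, k (p x) = !k x)
    (hq : ∀ x, k (q x) = !k x) (ht : ∀ x, k (t x) = k x) :
    ∃ c d : M.Aut, c ^ 2 = 1 ∧ Subgroup.closure {c, d} = ⊤ ∧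
      ∀ e : M.Aut ≃* M.Aut, e c = c → e d ≠ d⁻¹ := by
  obtain ⟨x⟩ := M.nonempty
  obtain ⟨c, hc⟩ := (hk x (t x)).1 (ht x).symm
  obtain ⟨d, hd⟩ := (hk (p x) (q x)).1 (by rw [hp, hq])
  have hc2 : c ^ 2 = 1 := by
    apply eq_of_smul_eq (x := x)
    rw [pow_two, mul_smul, hc, ← smul_apply_of_mem c h.t_mem, hc, h.tt, one_smul]
  have hcp : c • p x = t (p x) := by rw [← smul_apply_of_mem c h.p_mem, hc, h.pt]
  have hd' : d⁻¹ • x = q (p x) := by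
    rw [inv_smul_eq_iff, ← smul_apply_of_mem d h.q_mem, hd, h.qq]
  have hkx : ∀ a : M.Aut, ∀ y, k (a • y) = k y := fun a y => ((hk _ _).2 ⟨a, rfl⟩).symm
  refine ⟨c, d, hc2, ?_, fun e hec hed => ?_⟩
  · have hc' : c ∈ Subgroup.closure {c, d} := Subgroup.subset_closure (by simp)
    have hdm : d ∈ Subgroup.closure {c, d} := Subgroup.subset_closure (by simp)
    rw [eq_top_iff]
    intro a _
    have key : ∀ y, ∃ e ∈ Subgroup.closure {c, d}, e • x = y ∨ e • p x = y := by
      refine h.induction (x := x) ⟨1, Subgroup.one_mem _, Or.inl (one_smul _ x)⟩ ?_ ?_ ?_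
      · rintro y ⟨e, he, rfl | rfl⟩
        · exact ⟨e, he, Or.inr (smul_apply_of_mem e h.p_mem _).symm⟩
        · exact ⟨e, he, Or.inl (by rw [smul_apply_of_mem e h.p_mem, h.pp])⟩
      · rintro y ⟨e, he, rfl | rfl⟩
        · exact ⟨e * d, Subgroup.mul_mem _ he hdm,
            Or.inr (by rw [mul_smul, hd, smul_apply_of_mem e h.q_mem])⟩
        · exact ⟨e * d⁻¹, Subgroup.mul_mem _ he (Subgroup.inv_mem _ hdm),
            Or.inl (by rw [mul_smul, hd', smul_apply_of_mem e h.q_mem])⟩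
      · rintro y ⟨e, he, rfl | rfl⟩
        · exact ⟨e * c, Subgroup.mul_mem _ he hc',
            Or.inl (by rw [mul_smul, hc, smul_apply_of_mem e h.t_mem])⟩
        · exact ⟨e * c, Subgroup.mul_mem _ he hc',
            Or.inr (by rw [mul_smul, hcp, smul_apply_of_mem e h.t_mem])⟩
    obtain ⟨e, he, hed | hed⟩ := key (a • x)
    · rwa [← eq_of_smul_eq hed]
    · exfalso
      have h1 : k (p x) = k x := (hk _ _).2 ⟨a⁻¹ * e, by rw [mul_smul, hed, inv_smul_smul]⟩
      rw [hp] at h1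
      exact Bool.not_ne_self _ h1
  · have hex : ∀ y, ∃ a : M.Aut, a • x = y ∨ a • p x = y := fun y => by
      by_cases hy : k y = k x
      · obtain ⟨a, ha⟩ := (hk x y).1 hy.symm
        exact ⟨a, Or.inl ha⟩
      · obtain ⟨a, ha⟩ := (hk (p x) y).1 (by
          rw [hp]
          revert hy
          cases k x <;> cases k y <;> simp)
        exact ⟨a, Or.inr ha⟩
    have hne : ∀ a b : M.Aut, a • x ≠ b • p x := fun a b hab => by
      have := congrArg k hab
      rw [hkx, hkx, hp] at this
      exact Bool.not_ne_self _ this.symm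
    classical
    -- `F` exchanges the base flags `x` and `p x` and twists translations by `e`. That `e` fixes `c`
    -- makes it commute with `t`, and that `e` inverts `d` makes it commute with `q`, so it is an
    -- automorphism exchanging the two orbits.
    have hF : ∃ F : M.Flag → M.Flag, (∀ a : M.Aut, F (a • x) = e a • p x) ∧
        ∀ a : M.Aut, F (a • p x) = e a • x := by
      choose g hg using hex
      refine ⟨fun y => if g y • x = y then e (g y) • p x else e (g y) • x, fun a => ?_,
        fun a => ?_⟩
      · have h1 := (hg (a • x)).resolve_right fun h1 => hne _ _ h1.symm
        dsimp only
        rw [if_pos h1, eq_of_smul_eq h1]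
      · have h1 := (hg (a • p x)).resolve_left (hne _ _)
        dsimp only
        rw [if_neg (hne _ _), eq_of_smul_eq h1]
    obtain ⟨F, hF1, hF2⟩ := hF
    have hFbij : F.Bijective := by
      constructor
      · intro y z hyz
        obtain ⟨a, rfl | rfl⟩ := hex y <;> obtain ⟨b, rfl | rfl⟩ := hex z
        · rw [hF1, hF1] at hyz
          rw [e.injective (eq_of_smul_eq hyz)]
        · rw [hF1, hF2] at hyz
          exact absurd hyz.symm (hne _ _)
        · rw [hF1, hF2] at hyz
          exact absurd hyz (hne _ _)
        · rw [hF2, hF2] at hyz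
          rw [e.injective (eq_of_smul_eq hyz)]
      · intro y
        obtain ⟨a, rfl | rfl⟩ := hex y
        · exact ⟨e.symm a • p x, by rw [hF2, e.apply_symm_apply]⟩
        · exact ⟨e.symm a • x, by rw [hF1, e.apply_symm_apply]⟩
    have hFa : Equiv.ofBijective F hFbij ∈ M.Aut := by
      refine h.mem_aut (fun y => ?_) (fun y => ?_) fun y => ?_
      · change F (p y) = p (F y)
        obtain ⟨a, rfl | rfl⟩ := hex y
        · rw [smul_apply_of_mem _ h.p_mem, hF2, hF1, smul_apply_of_mem _ h.p_mem, h.pp]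
        · rw [smul_apply_of_mem _ h.p_mem, h.pp, hF2, hF1, smul_apply_of_mem _ h.p_mem]
      · change F (q y) = q (F y)
        obtain ⟨a, rfl | rfl⟩ := hex y
        · rw [smul_apply_of_mem _ h.q_mem, hF1, smul_apply_of_mem _ h.q_mem, ← hd', ← hd,
            ← mul_smul, ← mul_smul, hF2, map_mul, hed]
        · rw [smul_apply_of_mem _ h.q_mem, hF2, smul_apply_of_mem _ h.q_mem, ← hd', ← hd,
            ← mul_smul, ← mul_smul, hF1, map_mul, map_inv, hed, inv_inv]
      · change F (t y) = t (F y)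
        obtain ⟨a, rfl | rfl⟩ := hex y
        · rw [smul_apply_of_mem _ h.t_mem, hF1, smul_apply_of_mem _ h.t_mem, ← hc, ← hcp,
            ← mul_smul, ← mul_smul, hF1, map_mul, hec]
        · rw [smul_apply_of_mem _ h.t_mem, hF2, smul_apply_of_mem _ h.t_mem, ← hc, ← hcp,
            ← mul_smul, ← mul_smul, hF2, map_mul, hec]
    have h1 : k (F x) = k x := hkx ⟨_, hFa⟩ x
    have h2 := hF1 1
    rw [one_smul] at h2
    rw [h2, hkx, hp] at h1
    exact Bool.not_ne_self _ h1

end IsGenTriple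

end FlagMap

/-! ### The classes in which `U₃(3)` is not realised -/

namespace SU33

open FlagMap

variable {M : FlagMap}

theorem false_of_closure_three (e : SU33 ≃* M.Aut)
    (h : ∃ a b c : M.Aut, a ^ 2 = 1 ∧ b ^ 2 = 1 ∧ c ^ 2 = 1 ∧ Subgroup.closure {a, b, c} = ⊤) :
    False := by
  obtain ⟨a, b, c, ha, hb, hc, htop⟩ := h
  have hsq : ∀ a : M.Aut, a ^ 2 = 1 → e.symm a ^ 2 = 1 := fun a ha => by
    rw [← map_pow, ha, map_one]
  refine closure_ne_top_of_sq (hsq a ha) (hsq b hb) (hsq c hc) ?_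
  have := congrArg (Subgroup.map e.symm.toMonoidHom) htop
  rw [MonoidHom.map_closure, Subgroup.map_top_of_surjective _ e.symm.surjective] at this
  simpa [Set.image_insert_eq] using this

theorem false_of_closure_two (e : SU33 ≃* M.Aut)
    (h : ∃ c d : M.Aut, c ^ 2 = 1 ∧ Subgroup.closure {c, d} = ⊤ ∧
      ∀ e : M.Aut ≃* M.Aut, e c = c → e d ≠ d⁻¹) : False := by
  obtain ⟨c, d, hc, htop, hno⟩ := h
  have htop' : Subgroup.closure {e.symm c, e.symm d} = ⊤ := by
    have := congrArg (Subgroup.map e.symm.toMonoidHom) htop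
    rw [MonoidHom.map_closure, Subgroup.map_top_of_surjective _ e.symm.surjective] at this
    simpa [Set.image_insert_eq] using this
  obtain ⟨f, hfc, hfd⟩ := exists_mulEquiv_inv (by rw [← map_pow, hc, map_one]) htop'
  refine hno ((e.symm.trans f).trans e) ?_ ?_
  · simp [hfc]
  · simp [hfd]

theorem flip_true_apply (b : Bool) : FlagMap.flip true b = !b := by cases b <;> rfl

theorem not_inClass_one (e : SU33 ≃* M.Aut) : ¬ M.InClass .one := by
  rintro ⟨-, h⟩
  obtain ⟨k, -, -, -, hk⟩ := exists_isotopy h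
  exact false_of_closure_three e
    (M.isGenTriple.exists_closure_eq_top_of_transitive fun x y => (hk x y).1 rfl)

theorem not_inClass_two (e : SU33 ≃* M.Aut) (σ : ClassSuffix) : ¬ M.InClass (.two σ) := by
  rintro ⟨-, h⟩
  obtain ⟨k, h0, h1, h2, hk⟩ := exists_isotopy h
  apply false_of_closure_three e
  cases σ
  · exact M.isGenTriple.exists_closure_eq_top_of_two k hk
      (fun x => (h0 x).trans (flip_true_apply _)) h1 h2
  · exact M.isGenTriple_dual.exists_closure_eq_top_of_two k hk
      (fun x => (h2 x).trans (flip_true_apply _)) h1 h0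
  · refine M.isGenTriple_petrie.exists_closure_eq_top_of_two k hk
      (fun x => (h0 x).trans (flip_true_apply _)) h1 fun x => ?_
    rw [Equiv.Perm.mul_apply]
    exact (h0 _).trans ((flip_true_apply _).trans
      ((congrArg _ ((h2 x).trans (flip_true_apply _))).trans (Bool.not_not _)))

theorem not_inClass_twoEx (e : SU33 ≃* M.Aut) (σ : ClassSuffix) : ¬ M.InClass (.twoEx σ) := by
  rintro ⟨-, h⟩
  obtain ⟨k, h0, h1, h2, hk⟩ := exists_isotopy h
  apply false_of_closure_two e
  cases σ
  · exact M.isGenTriple.exists_closure_eq_top_of_twoEx k hk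
      (fun x => (h0 x).trans (flip_true_apply _)) (fun x => (h1 x).trans (flip_true_apply _)) h2
  · exact M.isGenTriple_dual.exists_closure_eq_top_of_twoEx k hk
      (fun x => (h2 x).trans (flip_true_apply _)) (fun x => (h1 x).trans (flip_true_apply _)) h0
  · refine M.isGenTriple_petrie.exists_closure_eq_top_of_twoEx k hk
      (fun x => (h0 x).trans (flip_true_apply _)) (fun x => (h1 x).trans (flip_true_apply _))
      fun x => ?_
    rw [Equiv.Perm.mul_apply]
    exact (h0 _).trans ((flip_true_apply _).trans
      ((congrArg _ ((h2 x).trans (flip_true_apply _))).trans (Bool.not_not _)))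

end SU33

/-! ### Maps with a regular group of automorphisms on each of four classes of flags -/

namespace FlagMap

theorem exists_mem_closure_flip {G : Type} {T : Set (Equiv.Perm (G × (Bool × Bool)))}
    (h0 : Equiv.prodCongr (Equiv.refl G) flipFst ∈ T)
    (h2 : Equiv.prodCongr (Equiv.refl G) flipSnd ∈ T) (f f' : Bool × Bool) :
    ∃ w ∈ Subgroup.closure T, ∀ g, w (g, f) = (g, f') := by
  have key : ∀ x y : Bool × Bool, x = y ∨ flipFst x = y ∨ flipSnd x = y ∨
      flipFst (flipSnd x) = y := by decide
  have h0' := Subgroup.subset_closure h0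
  have h2' := Subgroup.subset_closure h2
  rcases key f f' with rfl | rfl | rfl | rfl
  · exact ⟨1, Subgroup.one_mem _, fun g => rfl⟩
  · exact ⟨_, h0', fun g => rfl⟩
  · exact ⟨_, h2', fun g => rfl⟩
  · exact ⟨_, Subgroup.mul_mem _ h0' h2', fun g => rfl⟩

section voltage

variable {G : Type} [Group G] (s : Equiv.Perm (Bool × Bool)) (v : Bool × Bool → G)

/-- The permutation of `G × (Bool × Bool)` which covers `s`, with voltages `v`. -/
def voltagePerm (h : ∀ f, v f * v (s f) = 1) (hs : ∀ f, s (s f) = f) :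
    Equiv.Perm (G × (Bool × Bool)) where
  toFun x := (x.1 * v x.2, s x.2)
  invFun x := (x.1 * v x.2, s x.2)
  left_inv x := by simp only [hs, mul_assoc, h, mul_one]
  right_inv x := by simp only [hs, mul_assoc, h, mul_one]

/-- The map with flags `G × (Bool × Bool)` in which `r₀` and `r₂` transpose the values of the
coordinates in the second factor and `r₁` covers `s` with voltages `v`. -/
def voltageMap (h : ∀ f, v f * v (s f) = 1) (hs : ∀ f, s (s f) = f)
    (hv : Subgroup.closure (Set.range v) = ⊤) : FlagMap where
  Flag := G × (Bool × Bool)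
  nonempty := ⟨(1, false, false)⟩
  r₀ := Equiv.prodCongr (Equiv.refl G) flipFst
  r₁ := voltagePerm s v h hs
  r₂ := Equiv.prodCongr (Equiv.refl G) flipSnd
  r₀_sq := by
    ext ⟨g, a, b⟩ : 1
    cases a <;> rfl
  r₁_sq := by
    ext ⟨g, f⟩ : 1
    exact (voltagePerm s v h hs).left_inv (g, f)
  r₂_sq := by
    ext ⟨g, a, b⟩ : 1
    cases b <;> rfl
  r₀r₂_sq := by
    ext ⟨g, a, b⟩ : 1
    cases a <;> cases b <;> rfl
  connected := by
    have hE := exists_mem_closure_flip (G := G)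
      (T := {Equiv.prodCongr (Equiv.refl G) flipFst, voltagePerm s v h hs,
        Equiv.prodCongr (Equiv.refl G) flipSnd}) (by simp) (by simp)
    -- Right multiplication by any product of voltages is realised by a monodromy element, which may
    -- depend on `g` and `f`.
    have key : ∀ d : G, ∀ g f, ∃ w ∈ Subgroup.closure
        {Equiv.prodCongr (Equiv.refl G) flipFst, voltagePerm s v h hs,
          Equiv.prodCongr (Equiv.refl G) flipSnd}, w (g, f) = (g * d, f) := by
      intro d
      have hd : d ∈ Subgroup.closure (Set.range v) := by rw [hv]; trivial
      induction hd using Subgroup.closure_induction with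
      | mem d hd =>
        obtain ⟨e, rfl⟩ := hd
        intro g f
        obtain ⟨w, hw, hwe⟩ := hE f e
        obtain ⟨w', hw', hwe'⟩ := hE (s e) f
        refine ⟨w' * (voltagePerm s v h hs * w), Subgroup.mul_mem _ hw'
          (Subgroup.mul_mem _ (Subgroup.subset_closure (by simp)) hw), ?_⟩
        rw [Equiv.Perm.mul_apply, Equiv.Perm.mul_apply, hwe]
        exact hwe' _
      | one => exact fun g f => ⟨1, Subgroup.one_mem _, by rw [mul_one]; rfl⟩
      | mul a b _ _ iha ihb =>
        intro g f
        obtain ⟨w, hw, hwe⟩ := iha g f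
        obtain ⟨w', hw', hwe'⟩ := ihb (g * a) f
        exact ⟨w' * w, Subgroup.mul_mem _ hw' hw, by
          rw [Equiv.Perm.mul_apply, hwe, hwe', mul_assoc]⟩
      | inv a _ iha =>
        intro g f
        obtain ⟨w, hw, hwe⟩ := iha (g * a⁻¹) f
        exact ⟨w⁻¹, Subgroup.inv_mem _ hw, by
          rw [Equiv.Perm.inv_eq_iff_eq, hwe, inv_mul_cancel_right]⟩
    rintro ⟨g, f⟩ ⟨g', f'⟩
    obtain ⟨w, hw, hwe⟩ := key (g⁻¹ * g') g f
    obtain ⟨w', hw', hwe'⟩ := hE f f'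
    exact ⟨w' * w, Subgroup.mul_mem _ hw' hw, by
      rw [Equiv.Perm.mul_apply, hwe, hwe', mul_inv_cancel_left]⟩

variable {s v} {h : ∀ f, v f * v (s f) = 1} {hs : ∀ f, s (s f) = f}
  {hv : Subgroup.closure (Set.range v) = ⊤}

/-- The left translations are automorphisms. -/
def translation (h : ∀ f, v f * v (s f) = 1) (hs : ∀ f, s (s f) = f)
    (hv : Subgroup.closure (Set.range v) = ⊤) : G →* (voltageMap s v h hs hv).Aut where
  toFun g := ⟨Equiv.prodCongr (Equiv.mulLeft g) (Equiv.refl _),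
    (isGenTriple _).mem_aut (fun _ => rfl)
      (fun _ => Prod.ext (mul_assoc _ _ _).symm rfl) (fun _ => rfl)⟩
  map_one' := Subtype.ext (Equiv.ext fun _ => Prod.ext (one_mul _) rfl)
  map_mul' _ _ := Subtype.ext (Equiv.ext fun _ => Prod.ext (mul_assoc _ _ _) rfl)

/-- A flag of `voltageMap`. -/
def voltageFlag (h : ∀ f, v f * v (s f) = 1) (hs : ∀ f, s (s f) = f)
    (hv : Subgroup.closure (Set.range v) = ⊤) (x : G × (Bool × Bool)) :
    (voltageMap s v h hs hv).Flag := x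

theorem translation_smul (g : G) (x : G × (Bool × Bool)) :
    translation h hs hv g • voltageFlag h hs hv x = voltageFlag h hs hv (g * x.1, x.2) := rfl

/-- After a translation, an automorphism takes the base flag to some `(1, f)`. It commutes with the
monodromy group, so both flags have the same stabiliser there, and the given `w` excludes every
other class `f`. -/
theorem translation_surjective (hasym : ∀ f, f ≠ (false, false) →
    ∃ w ∈ (voltageMap s v h hs hv).monodromy,
      w (1, false, false) = (1, false, false) ∧ w (1, f) ≠ (1, f)) :
    Function.Surjective (translation h hs hv) := by
  intro a
  obtain ⟨⟨g, f⟩, ha⟩ : ∃ y : G × (Bool × Bool),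
    a • voltageFlag h hs hv (1, false, false) = voltageFlag h hs hv y := ⟨_, rfl⟩
  have hf : f = (false, false) := by
    by_contra hf
    obtain ⟨w, hw, hw1, hw2⟩ := hasym f hf
    apply hw2
    have h1 : ((translation h hs hv g)⁻¹ * a) • voltageFlag h hs hv (1, false, false) =
        voltageFlag h hs hv (1, f) := by
      rw [mul_smul, ha, inv_smul_eq_iff, translation_smul, mul_one]
    have h2 := smul_apply_of_mem ((translation h hs hv g)⁻¹ * a) hw
      (voltageFlag h hs hv (1, false, false))
    rw [h1] at h2
    exact h2.trans ((congrArg (((translation h hs hv g)⁻¹ * a) • ·) hw1).trans h1)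
  subst hf
  refine ⟨g, eq_of_smul_eq (x := voltageFlag h hs hv (1, false, false)) ?_⟩
  rw [ha, translation_smul, mul_one]

theorem translation_injective : Function.Injective (translation h hs hv) := by
  intro a b hab
  have hab : translation h hs hv a • voltageFlag h hs hv (1, false, false) =
    translation h hs hv b • voltageFlag h hs hv (1, false, false) := by rw [hab]
  rw [translation_smul, translation_smul, mul_one, mul_one] at hab
  exact congrArg Prod.fst hab

/-- If no automorphism moves the flag `(1, (false, false))` to a flag in another class, the group
`G` is realised in the class with basic map `basicFour s`. -/
theorem realisedInClass_of_voltage {T : EdgeClass} (hs2 : s ^ 2 = 1)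
    (hT : T.basicMap = basicFour s hs2) (hasym : ∀ f, f ≠ (false, false) →
    ∃ w ∈ (voltageMap s v h hs hv).monodromy,
      w (1, false, false) = (1, false, false) ∧ w (1, f) ≠ (1, f)) :
    RealisedInClass G T := by
  have hsurj := translation_surjective hasym
  refine ⟨voltageMap s v h hs hv, ⟨?_, ?_⟩,
    ⟨MulEquiv.ofBijective _ ⟨translation_injective, hsurj⟩⟩⟩
  · rintro ⟨g, f⟩ ⟨g', f'⟩
    obtain ⟨w, hw, hwe⟩ := exists_mem_closure_flip (G := G)
      (T := {Equiv.prodCongr (Equiv.refl G) flipFst, Equiv.prodCongr (Equiv.refl G) flipSnd})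
      (by simp) (by simp) f' f
    refine ⟨_, (translation h hs hv (g' * g⁻¹)).2, ⟨⟨w, hw⟩, ?_⟩⟩
    exact (hwe g').trans (Prod.ext (inv_mul_cancel_right g' g).symm rfl)
  · rw [hT]
    refine ⟨⟨Quotient.lift (fun x : G × (Bool × Bool) => x.2) ?_,
      fun f => Quotient.mk _ ((1, f) : G × (Bool × Bool)), ?_, fun f => rfl⟩, ?_, ?_, ?_⟩
    · rintro x y ⟨a, rfl⟩
      obtain ⟨g, rfl⟩ := hsurj a
      rfl
    · intro x
      induction x using Quotient.inductionOn with
      | h x => exact Quotient.sound ⟨translation h hs hv x.1⁻¹,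
          Prod.ext (inv_mul_cancel x.1) rfl⟩
    all_goals
      intro x
      induction x using Quotient.inductionOn with
      | h x => rfl

end voltage

end FlagMap

/-! ### The classes in which `U₃(3)` is realised -/

namespace SU33

open FlagMap

/-- One step of a walk on the flags of a map with words as voltages. -/
def walkStep (s : Equiv.Perm (Bool × Bool)) (u : Bool × Bool → List ℕ) (i : Fin 3)
    (p : List ℕ × (Bool × Bool)) : List ℕ × (Bool × Bool) :=
  ![(p.1, flipFst p.2), (p.1 ++ u p.2, s p.2), (p.1, flipSnd p.2)] i

/-- A walk on the flags of a map with words as voltages. -/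
def walk (s : Equiv.Perm (Bool × Bool)) (u : Bool × Bool → List ℕ) (w : List (Fin 3))
    (p : List ℕ × (Bool × Bool)) : List ℕ × (Bool × Bool) :=
  w.foldl (fun p i => walkStep s u i p) p

/-- The walk `w` which starts in `f` is closed and has trivial voltage. -/
def IsClosedWalk (s : Equiv.Perm (Bool × Bool)) (u : Bool × Bool → List ℕ) (w : List (Fin 3))
    (f : Bool × Bool) : Prop :=
  (walk s u w ([], f)).2 = f ∧ wordVec (walk s u w ([], f)).1 1 = 1 ∧
    wordVec (walk s u w ([], f)).1 9 = 9 ∧ wordVec (walk s u w ([], f)).1 81 = 81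

instance (s : Equiv.Perm (Bool × Bool)) (u : Bool × Bool → List ℕ) (w : List (Fin 3))
    (f : Bool × Bool) : Decidable (IsClosedWalk s u w f) := by
  unfold IsClosedWalk
  infer_instance

theorem isWord_walk {s : Equiv.Perm (Bool × Bool)} {u : Bool × Bool → List ℕ}
    (hu : ∀ f, IsWord (u f)) (w : List (Fin 3)) {p : List ℕ × (Bool × Bool)} (hp : IsWord p.1) :
    IsWord (walk s u w p).1 := by
  induction w generalizing p with
  | nil => exact hp
  | cons i w ih =>
    apply ih
    fin_cases i
    · exact hp
    · intro c hc
      rcases List.mem_append.1 hc with hc | hc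
      · exact hp c hc
      · exact hu _ c hc
    · exact hp

/-- Letters are involutions, so reversing a word inverts it, and the condition on `u` says that `r₁`
is an involution. The walks supply the monodromy elements separating the classes of flags, with
trivial voltage tested on the standard basis. -/
theorem realisedInClass_of_words {T : EdgeClass} {s : Equiv.Perm (Bool × Bool)}
    (u : Bool × Bool → List ℕ) (hu : ∀ f, IsWord (u f)) (hus : ∀ f, u (s f) = (u f).reverse)
    (hs2 : s ^ 2 = 1)
    (hT : T.basicMap = basicFour s hs2)
    (hv : Subgroup.closure (Set.range fun f => wordElt (u f)) = ⊤)
    (w : Bool × Bool → List (Fin 3)) (hw : ∀ f, f ≠ (false, false) →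
      IsClosedWalk s u (w f) (false, false) ∧ ¬ IsClosedWalk s u (w f) f) :
    RealisedInClass SU33 T := by
  have h : ∀ f, wordElt (u f) * wordElt (u (s f)) = 1 := fun f => by
    rw [hus, wordElt_reverse, mul_inv_cancel]
  have hs : ∀ f, s (s f) = f := apply_apply_of_sq hs2
  refine realisedInClass_of_voltage (h := h) (hs := hs) (hv := hv) hs2 hT fun f hf => ?_
  -- The first letter of a walk acts first, hence is the rightmost factor of the permutation.
  have hwalk : ∀ w : List (Fin 3), ∃ g ∈ (voltageMap s _ h hs hv).monodromy,
      ∀ p : List ℕ × (Bool × Bool), g (wordElt p.1, p.2) =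
        (wordElt (walk s u w p).1, (walk s u w p).2) := fun w => by
    induction w with
    | nil => exact ⟨1, Subgroup.one_mem _, fun p => rfl⟩
    | cons i w ih =>
      obtain ⟨g, hg, hgp⟩ := ih
      obtain ⟨r, hr, hrp⟩ : ∃ r ∈ (voltageMap s _ h hs hv).monodromy,
          ∀ p : List ℕ × (Bool × Bool), r (wordElt p.1, p.2) =
            (wordElt (walkStep s u i p).1, (walkStep s u i p).2) := by
        fin_cases i
        · exact ⟨_, r₀_mem _, fun p => rfl⟩
        · exact ⟨_, r₁_mem _, fun p => Prod.ext (wordElt_append _ _).symm rfl⟩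
        · exact ⟨_, r₂_mem _, fun p => rfl⟩
      exact ⟨g * r, Subgroup.mul_mem _ hg hr, fun p => (congrArg g (hrp p)).trans (hgp _)⟩
  have hclosed : ∀ f', IsClosedWalk s u (w f) f' ↔
      ((wordElt (walk s u (w f) ([], f')).1, (walk s u (w f) ([], f')).2) :
        SU33 × (Bool × Bool)) = (1, f') := fun f' => by
    rw [IsClosedWalk, ← wordElt_eq_one_iff (isWord_walk hu (w f) (by simp [IsWord]))]
    exact ⟨fun e => Prod.ext e.2 e.1, fun e => ⟨congrArg Prod.snd e, congrArg Prod.fst e⟩⟩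
  obtain ⟨g, hg, hgp⟩ := hwalk (w f)
  obtain ⟨h1, h2⟩ := hw f hf
  rw [hclosed] at h1 h2
  exact ⟨g, hg, (hgp ([], false, false)).trans h1, fun h3 => h2 ((hgp ([], f)).symm.trans h3)⟩

end SU33

/-! ### Explicit voltages in the classes `3`, `4`, `5` -/

namespace SU33

open FlagMap

/-- The words which are the voltages in class `3`. -/
def threeWords : Bool × Bool → List ℕ
  | (false, false) => [1]
  | (true, false) => [9]
  | (false, true) => [307]
  | (true, true) => [235]

/-- Write `cₙ` for the involution with code `n`. The walks express that `(c₁ c₃₀₇)³ = 1` but `(c₉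
c₂₃₅)³ ≠ 1`, which excludes the flag `(true, false)`, and that `(c₁ c₉)² = 1` while `c₃₀₇` and
`c₂₃₅` do not commute, which excludes the other two. -/
theorem realisedInClass_three : RealisedInClass SU33 .three := by
  refine realisedInClass_of_words threeWords (by decide) (by decide) (one_pow 2) rfl ?_
    (fun f => if f = (true, false) then [1, 2, 1, 2, 1, 2, 1, 2, 1, 2, 1, 2]
      else [1, 0, 1, 0, 1, 0, 1, 0]) (by decide +kernel)
  have hmem : ∀ f, wordElt (threeWords f) ∈
      Subgroup.closure (Set.range fun f => wordElt (threeWords f)) := fun f =>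
    Subgroup.subset_closure ⟨f, rfl⟩
  refine eq_top_of_orbitCovers (ws := [[1], [9], [307], [235]]) (c := 1) (by decide) ?_ ?_ ?_
  · simp only [List.forall_mem_cons]
    exact ⟨hmem (false, false), hmem (true, false), hmem (false, true), hmem (true, true),
      List.forall_mem_nil _⟩
  · simpa [wordElt, threeWords] using hmem (false, false)
  · rw [orbitCovers, lines_eq]
    decide +kernel

/-- The flag classes `t` and `a` of the one-edge map, where `t` is the image of `(false, false)`
under the permutation of the same name in the definition of the class, and `a` is not in its
orbit. -/
def suffixFlags : ClassSuffix → (Bool × Bool) × (Bool × Bool)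
  | .none => ((false, true), (true, false))
  | .star => ((true, false), (false, true))
  | .petrie => ((true, true), (true, false))

/-- Words for the permutations which take `(false, false)` to the flag classes `t` and `a`. -/
def suffixLetters : ClassSuffix → List (Fin 3) × List (Fin 3)
  | .none => ([2], [0])
  | .star => ([0], [2])
  | .petrie => ([0, 2], [0])

/-- The words which are the voltages in the classes `4` and `5`. -/
def suffixWords (b c d : List ℕ) (σ : ClassSuffix) (f : Bool × Bool) : List ℕ :=
  if f = (false, false) then b else if f = (suffixFlags σ).1 then c else
    if f = (suffixFlags σ).2 then d else d.reverse

theorem suffixWords_mem (b c d : List ℕ) (σ : ClassSuffix) :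
    wordElt b ∈ Subgroup.closure (Set.range fun f => wordElt (suffixWords b c d σ f)) ∧
    wordElt c ∈ Subgroup.closure (Set.range fun f => wordElt (suffixWords b c d σ f)) ∧
    wordElt d ∈ Subgroup.closure (Set.range fun f => wordElt (suffixWords b c d σ f)) := by
  refine ⟨Subgroup.subset_closure ⟨(false, false), rfl⟩,
    Subgroup.subset_closure ⟨(suffixFlags σ).1, ?_⟩,
    Subgroup.subset_closure ⟨(suffixFlags σ).2, ?_⟩⟩ <;> cases σ <;> rfl

/-- The voltages in the classes `4`. -/
def fourWords : ClassSuffix → Bool × Bool → List ℕ := suffixWords [1] [9] [199, 67, 424]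

theorem closure_fourWords (σ : ClassSuffix) :
    Subgroup.closure (Set.range fun f => wordElt (fourWords σ f)) = ⊤ := by
  obtain ⟨h1, h2, h3⟩ := suffixWords_mem [1] [9] [199, 67, 424] σ
  refine eq_top_of_orbitCovers (ws := [[1], [9], [199, 67, 424]]) (c := 1) (by decide) ?_ ?_ ?_
  · simp only [List.forall_mem_cons]
    exact ⟨h1, h2, h3, List.forall_mem_nil _⟩
  · rwa [wordElt, wordElt, mul_one] at h1
  · rw [orbitCovers, lines_eq]
    decide +kernel

/-- Walks which distinguish the classes of flags in the classes `4`. -/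
def fourWalks (σ : ClassSuffix) (f : Bool × Bool) : List (Fin 3) :=
  let t := (suffixLetters σ).1
  let a := (suffixLetters σ).2
  -- For voltages `b`, `c`, `d`, the walk `w` has voltage `b · d b d⁻¹` from the base flag and `c ·
  -- d⁻¹ c d` from its image under `t`; only the first squares to `1`. The other walk has voltage
  -- `(b c)² = 1` from the base flag but `d⁴ ≠ 1` or its inverse from the remaining two.
  let w := 1 :: a ++ 1 :: t ++ a ++ 1 :: a ++ t ++ 1 :: a
  if f = (suffixFlags σ).1 then w ++ w else 1 :: t ++ 1 :: t ++ 1 :: t ++ 1 :: t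

theorem realisedInClass_four (σ : ClassSuffix) : RealisedInClass SU33 (.four σ) := by
  cases σ
  · exact realisedInClass_of_words (fourWords .none) (by decide) (by decide) _ rfl
      (closure_fourWords _) (fourWalks .none) (by decide +kernel)
  · exact realisedInClass_of_words (fourWords .star) (by decide) (by decide) _ rfl
      (closure_fourWords _) (fourWalks .star) (by decide +kernel)
  · exact realisedInClass_of_words (fourWords .petrie) (by decide) (by decide) _ rfl
      (closure_fourWords _) (fourWalks .petrie) (by decide +kernel)

/-- The voltages in the classes `5`. -/
def fiveWords : ClassSuffix → Bool × Bool → List ℕ :=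
  suffixWords [379, 226] [226, 379] [523, 265, 199]

theorem closure_fiveWords (σ : ClassSuffix) :
    Subgroup.closure (Set.range fun f => wordElt (fiveWords σ f)) = ⊤ := by
  obtain ⟨h1, -, h3⟩ := suffixWords_mem [379, 226] [226, 379] [523, 265, 199] σ
  refine eq_top_of_orbitCovers (ws := [[379, 226], [523, 265, 199]]) (c := 703) (by decide)
    ?_ ?_ ?_
  · simp only [List.forall_mem_cons]
    exact ⟨h1, h3, List.forall_mem_nil _⟩
  -- The first generator has order four; its square is the involution from which the orbit
  -- computation starts.
  · have h : wordElt ([379, 226] ++ [379, 226] ++ [703]) = 1 := by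
      rw [wordElt_eq_one_iff (by decide)]
      decide +kernel
    rw [wordElt_append, wordElt_append, wordElt.eq_2 703, wordElt.eq_1, mul_one] at h
    rw [← inv_eq_of_mul_eq_one_right h]
    exact Subgroup.inv_mem _ (Subgroup.mul_mem _ h1 h1)
  · rw [orbitCovers, lines_eq]
    decide +kernel

/-- Walks which distinguish the classes of flags in the classes `5`. -/
def fiveWalks (σ : ClassSuffix) (f : Bool × Bool) : List (Fin 3) :=
  let t := (suffixLetters σ).1
  let a := (suffixLetters σ).2
  let x := 1 :: t
  let x' := t ++ [1]
  let y := a ++ 1 :: t ++ a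
  let y' := a ++ t ++ 1 :: a
  -- From the base flag `x` and `y` have voltages `b` and `d`, and `x'`, `y'` their inverses; from
  -- its image under `t` all are inverted. The square of this word is trivial in `b`, `d` but not in
  -- `b⁻¹`, `d⁻¹`. The other two flags are excluded by `b⁴ = 1` and `d⁴ ≠ 1`.
  let w := x ++ x ++ y' ++ x' ++ y ++ y ++ x ++ x ++ y' ++ y' ++ x ++ y
  if f = (suffixFlags σ).1 then w ++ w else x ++ x ++ x ++ x

theorem realisedInClass_five (σ : ClassSuffix) : RealisedInClass SU33 (.five σ) := by
  cases σ
  · exact realisedInClass_of_words (fiveWords .none) (by decide) (by decide) _ rfl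
      (closure_fiveWords _) (fiveWalks .none) (by decide +kernel)
  · exact realisedInClass_of_words (fiveWords .star) (by decide) (by decide) _ rfl
      (closure_fiveWords _) (fiveWalks .star) (by decide +kernel)
  · exact realisedInClass_of_words (fiveWords .petrie) (by decide) (by decide) _ rfl
      (closure_fiveWords _) (fiveWalks .petrie) (by decide +kernel)

theorem realisedInClass_U33_iff (T : EdgeClass) :
    RealisedInClass U33 T ↔ RealisedInClass SU33 T :=
  ⟨fun ⟨M, hM, ⟨e⟩⟩ => ⟨M, hM, ⟨mulEquivU33.symm.trans e⟩⟩,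
    fun ⟨M, hM, ⟨e⟩⟩ => ⟨M, hM, ⟨mulEquivU33.trans e⟩⟩⟩

end SU33

theorem theorem9p1 (T : EdgeClass) :
    RealisedInClass U33 T ↔
      T = EdgeClass.three ∨ (∃ σ : ClassSuffix, T = EdgeClass.four σ) ∨
        ∃ σ : ClassSuffix, T = EdgeClass.five σ := by
  rw [SU33.realisedInClass_U33_iff]
  constructor
  · rintro ⟨M, hM, ⟨e⟩⟩
    cases T with
    | one => exact absurd hM (SU33.not_inClass_one e)
    | two σ => exact absurd hM (SU33.not_inClass_two e σ)
    | twoEx σ => exact absurd hM (SU33.not_inClass_twoEx e σ)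
    | three => exact Or.inl rfl
    | four σ => exact Or.inr (Or.inl ⟨σ, rfl⟩)
    | five σ => exact Or.inr (Or.inr ⟨σ, rfl⟩)
  · rintro (rfl | ⟨σ, rfl⟩ | ⟨σ, rfl⟩)
    · exact SU33.realisedInClass_three
    · exact SU33.realisedInClass_four σ
    · exact SU33.realisedInClass_five σ
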